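/- **Problem.** Let $n\ge 1$, let $\mathcal H_i:\mathbb R^p\times\mathbb R^q\to\mathbb R$ $(1\le i\le n)$, $\mathcal H:=\frac1n\sum_{i=1}^n\mathcal H_i$, let $f:\mathbb R^p\to\mathbb R\cup\{+\infty\}$ and $h:\mathbb R^q\to\mathbb R\cup\{+\infty\}$ be proper, closed and convex, and let $\mathcal L(w,u):=f(w)+\mathcal H(w,u)-h(u)$. Put $$\Phi_0(w):=\max_{u}\{\mathcal H(w,u)-h(u)\},\qquad \Psi_0:=\Phi_0+f,\qquad \Psi_0^\star:=\inf_w\Psi_0(w),$$ $$\mathcal G_\eta(w):=\eta^{-1}\big(w-\mathrm{prox}_{\eta f}(w-\eta\nabla\Phi_0(w))\big),\qquad \hat{\mathcal G}_{\eta}(w,u):=\eta^{-1}\big(u-\mathrm{prox}_{\eta h}(u+\eta\nabla_u\mathcal H(w,u))\big).$$ **Constants.** $L_w,L_u>0$; $L_f,\mu_H,\mu_h,\Theta_w,\sigma_w,\Theta_u,\sigma_u,\Lambda_1,\hat\Lambda_1\ge0$; $\Lambda_0,\hat\Lambda_0\ge1$; $\mu_\psi:=\mu_h+\mu_H>0$.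 Put $\kappa:=L_u/\mu_\psi$, $L_{\Phi_0}:=(1+\kappa)L_w$, $$C_w:=5L_w^2[\Lambda_1(3\Theta_w+1)+3\sigma_w^2],\qquad C_u:=\tfrac{L_u^2}{2}[\hat\Lambda_1(3\Theta_u+2)+3\sigma_u^2],$$ $$\bar\eta:=\min\Big\{\tfrac1{60\kappa^2L_u},\ \tfrac1{\sqrt{10\Lambda_0L_w^2(3\Theta_w+1)}},\ \tfrac{2\sqrt{L_u}}{\kappa\sqrt{15(4L_u^2+\mu_\psi^2)}},\ \tfrac{\sqrt{L_u}}{15\kappa\sqrt{2L_u^3\hat\Lambda_0(3\Theta_u+2)+\mu_\psi^2}},\ \tfrac1{4L_{\Phi_0}+L_w+L_f}\Big\}.$$ **Assumptions.** (i) $\Psi_0^\star>-\infty$. (ii) $h$ is $\mu_h$-strongly convex and has bounded domain. (iii) Each $\mathcal H_i$ is differentiable, $\mathcal H_i(w,\cdot)$ is $\mu_H$-strongly concave for every $w$, and for all $w,\hat w,u,\hat u$ $$\|\nabla\mathcal H_i(w,u)-\nabla\mathcal H_i(\hat w,\hat u)\|^2\le L_w^2\|w-\hat w\|^2+L_u^2\|u-\hat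 u\|^2 .$$ (iv) For all $(w,u)$: $\frac1n\sum_i\|\nabla_w\mathcal H_i-\nabla_w\mathcal H\|^2\le\Theta_w\|\nabla_w\mathcal H\|^2+\sigma_w^2$ and $\frac1n\sum_i\|\nabla_u\mathcal H_i-\nabla_u\mathcal H\|^2\le\Theta_u\|\nabla_u\mathcal H\|^2+\sigma_u^2$ at $(w,u)$. (v) $f(y)\le f(x)+\langle s,y-x\rangle+\frac{L_f}2\|y-x\|^2$ for all $x,y\in\mathrm{dom}\,f$ and $s\in\partial f(x)$. (vi) At the learning rates $\eta$ and $\hat\eta:=15\kappa^2\eta$ used below, $\|\nabla\Phi_0(w)\|^2\le\Lambda_0\|\mathcal G_\eta(w)\|^2+\Lambda_1$ for all $w\in\mathrm{dom}\,\Phi_0$, and $\|\nabla_u\mathcal H(w,u)\|^2\le\hat\Lambda_0\|\hat{\mathcal G}_{\hat\eta}(w,u)\|^2+\hat\Lambda_1$ for all $w\in\mathrm{dom}\,f$, $u\in\mathrm{dom}\,h$. **Algorithm.** Start at $(\widetilde w_0,\widetilde u_0)\in\mathrm{dom}\,f\times\mathrm{dom}\,h$. In iteration $t=1,2,\dots$,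 with arbitrary permutations $\pi^{(t)},\hat\pi^{(t)}$ of $\{1,\dots,n\}$, do one shuffling ascent epoch $$u_0^{(t)}:=\widetilde u_{t-1},\quad u_i^{(t)}:=u_{i-1}^{(t)}+\tfrac{\hat\eta}{n}\nabla_u\mathcal H_{\pi^{(t)}(i)}(\widetilde w_{t-1},u_{i-1}^{(t)})\ (i=1,\dots,n),\quad \widetilde u_t:=\mathrm{prox}_{\hat\eta h}(u_n^{(t)}),$$ then one shuffling descent epoch $$w_0^{(t)}:=\widetilde w_{t-1},\quad w_i^{(t)}:=w_{i-1}^{(t)}-\tfrac{\eta}{n}\nabla_w\mathcal H_{\hat\pi^{(t)}(i)}(w_{i-1}^{(t)},\widetilde u_t)\ (i=1,\dots,n),\quad \widetilde w_t:=\mathrm{prox}_{\eta f}(w_n^{(t)}).$$ **Theorem.** (a) Under (i)–(v), $\Phi_0$ is finite and differentiable on $\mathbb R^p$. (b) Under (i)–(vi), for every $\eta\in(0,\bar\eta]$, $\hat\eta=15\kappa^2\eta$, and every $T\ge0$, $$\frac1{T+1}\sum_{t=0}^T\|\mathcal G_\eta(\widetilde w_t)\|^2\le\frac{24[\Psi_0(\widetilde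 w_0)-\Psi_0^\star]+8[\Psi_0(\widetilde w_0)-\mathcal L(\widetilde w_0,\widetilde u_0)]}{\eta(T+1)}+8C_w\eta^2+\frac{8C_u\hat\eta^3}{\eta}.$$ (c) For every $\Delta$ there are $a,C>0$, depending only on $\Delta$ and the constants above (not on $n,p,q,\varepsilon$ or the problem), such that for every $\varepsilon>0$, with $\eta:=\min\{a\varepsilon,\bar\eta\}$, $\hat\eta:=15\kappa^2\eta$ and $T:=\lfloor C\varepsilon^{-3}\rfloor$, the following holds whenever (i)–(vi) hold and $3[\Psi_0(\widetilde w_0)-\Psi_0^\star]+\Psi_0(\widetilde w_0)-\mathcal L(\widetilde w_0,\widetilde u_0)\le\Delta$: one has $\frac1{T+1}\sum_{t=0}^T\|\mathcal G_\eta(\widetilde w_t)\|^2\le\varepsilon^2$; consequently $\|\mathcal G_\eta(\widehat w_T)\|^2\le\varepsilon^2$ if $\widehat w_T$ is an iterate among $\widetilde w_0,\dots,\widetilde w_T$ with the smallest $\|\mathcal G_\eta\|$, and $\mathbb E\|\mathcal G_\eta(\widehat w_T)\|^2\le\varepsilon^2$ if $\widehat w_T$ is chosen uniformly at random among them; and the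 $T$ iterations make at most $Cn\varepsilon^{-3}$ evaluations of the $\nabla_w\mathcal H_i$, at most $Cn\varepsilon^{-3}$ evaluations of the $\nabla_u\mathcal H_i$, and at most $C\varepsilon^{-3}$ evaluations of each of $\mathrm{prox}_{\eta f}$ and $\mathrm{prox}_{\hat\eta h}$. -/

import Mathlib

open scoped InnerProductSpace

namespace MinimaxShuffling

noncomputable section

/-! Convex analysis for functions with values in `ℝ ∪ {+∞}`, modelled as `EReal`-valued
functions that never take the value `⊥`. -/

/-- Effective domain. -/
def effDom {E : Type*} (g : E → EReal) : Set E := {x | g x < ⊤}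

/-- Real values of `g`; meaningful on `effDom g`. -/
def realPart {E : Type*} (g : E → EReal) (x : E) : ℝ := (g x).toReal

/-- `g` is proper, closed and `m`-strongly convex (just convex when `m = 0`). -/
structure ProperClosedStronglyConvex {E : Type*} [NormedAddCommGroup E] [InnerProductSpace ℝ E]
    (m : ℝ) (g : E → EReal) : Prop where
  ne_bot : ∀ x, g x ≠ ⊥
  nonempty_dom : (effDom g).Nonempty
  closed : LowerSemicontinuous g
  strongConvex : StrongConvexOn (effDom g) m (realPart g)

/-- `s` is a subgradient of `g` at `x`. -/
def IsSubgradient {E : Type*} [NormedAddCommGroup E] [InnerProductSpace ℝ E]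
    (g : E → EReal) (x s : E) : Prop :=
  ∀ y, g x + ((⟪s, y - x⟫_ℝ : ℝ) : EReal) ≤ g y

/-- `y` minimizes `z ↦ g z + ‖z - x‖² / (2 η)`. -/
def IsProx {E : Type*} [NormedAddCommGroup E] (g : E → EReal) (η : ℝ) (x y : E) : Prop :=
  ∀ z, g y + ((‖y - x‖ ^ 2 / (2 * η) : ℝ) : EReal) ≤
    g z + ((‖z - x‖ ^ 2 / (2 * η) : ℝ) : EReal)

/-- The proximal operator of `η g`: the minimizer of `z ↦ g z + ‖z - x‖² / (2 η)`, which
exists and is unique for `η > 0` and `g` proper, closed and convex. -/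
def prox {E : Type*} [NormedAddCommGroup E] (g : E → EReal) (η : ℝ) (x : E) : E :=
  Classical.epsilon (IsProx g η x)

/-! The minimax problem `min_w max_u  f w + (1/n) ∑ i, H i w u - h u`. -/

/-- Euclidean space of dimension `d`. -/
abbrev Euc (d : ℕ) : Type := EuclideanSpace ℝ (Fin d)

/-- Data of the minimax problem. -/
structure Problem (n p q : ℕ) where
  f : Euc p → EReal
  h : Euc q → EReal
  H : Fin n → Euc p → Euc q → ℝ

namespace Problem

variable {n p q : ℕ} (P : Problem n p q)

/-- `∇_w H_i(w, u)`. -/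
def gradW (i : Fin n) (w : Euc p) (u : Euc q) : Euc p := gradient (fun w' => P.H i w' u) w

/-- `∇_u H_i(w, u)`. -/
def gradU (i : Fin n) (w : Euc p) (u : Euc q) : Euc q := gradient (fun u' => P.H i w u') u

/-- The finite sum `H(w, u) = (1/n) ∑ i, H_i(w, u)`. -/
def avgH (w : Euc p) (u : Euc q) : ℝ := (1 / (n : ℝ)) * ∑ i, P.H i w u

/-- `∇_w H(w, u)`. -/
def avgGradW (w : Euc p) (u : Euc q) : Euc p := gradient (fun w' => P.avgH w' u) w

/-- `∇_u H(w, u)`. -/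
def avgGradU (w : Euc p) (u : Euc q) : Euc q := gradient (fun u' => P.avgH w u') u

/-- The objective `𝓛(w, u) = f(w) + H(w, u) - h(u)`. -/
def lagr (w : Euc p) (u : Euc q) : EReal := P.f w + ((P.avgH w u : ℝ) : EReal) - P.h u

/-- `Φ₀(w) = max_u { H(w, u) - h(u) }`. -/
def Phi (w : Euc p) : EReal := ⨆ u, (((P.avgH w u : ℝ) : EReal) - P.h u)

/-- `Ψ₀ = Φ₀ + f`. -/
def Psi (w : Euc p) : EReal := P.Phi w + P.f w

/-- `Ψ₀⋆ = inf_w Ψ₀(w)`. -/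
def PsiStar : EReal := ⨅ w, P.Psi w

/-- The hyper-gradient `∇Φ₀(w)`. -/
def gradPhi (w : Euc p) : Euc p := gradient (realPart P.Phi) w

/-- Gradient mapping `𝓖_η(w) = η⁻¹ (w - prox_{ηf}(w - η ∇Φ₀(w)))`. -/
def gradMap (η : ℝ) (w : Euc p) : Euc p :=
  η⁻¹ • (w - prox P.f η (w - η • P.gradPhi w))

/-- Gradient mapping of `-H(w, ·) + h`:
`Ĝ_η(u) = η⁻¹ (u - prox_{ηh}(u + η ∇_u H(w, u)))`. -/
def dualGradMap (η : ℝ) (w : Euc p) (u : Euc q) : Euc q :=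
  η⁻¹ • (u - prox P.h η (u + η • P.avgGradU w u))

end Problem

/-! Constants. -/

/-- The constants of the assumptions. -/
structure Consts where
  Lw : ℝ
  Lu : ℝ
  Lf : ℝ
  μH : ℝ
  μh : ℝ
  Θw : ℝ
  σw : ℝ
  Θu : ℝ
  σu : ℝ
  Λ0 : ℝ
  Λ1 : ℝ
  dΛ0 : ℝ
  dΛ1 : ℝ

namespace Consts

/-- The admissible ranges of the constants. -/
structure Valid (c : Consts) : Prop where
  Lw_pos : 0 < c.Lw
  Lu_pos : 0 < c.Lu
  Lf_nonneg : 0 ≤ c.Lf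
  μH_nonneg : 0 ≤ c.μH
  μh_nonneg : 0 ≤ c.μh
  μ_pos : 0 < c.μh + c.μH
  Θw_nonneg : 0 ≤ c.Θw
  σw_nonneg : 0 ≤ c.σw
  Θu_nonneg : 0 ≤ c.Θu
  σu_nonneg : 0 ≤ c.σu
  one_le_Λ0 : 1 ≤ c.Λ0
  Λ1_nonneg : 0 ≤ c.Λ1
  one_le_dΛ0 : 1 ≤ c.dΛ0
  dΛ1_nonneg : 0 ≤ c.dΛ1

variable (c : Consts)

/-- `μ_ψ = μ_h + μ_H`. -/
def μψ : ℝ := c.μh + c.μH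

/-- `κ = L_u / (μ_h + μ_H)`. -/
def κ : ℝ := c.Lu / c.μψ

/-- `L_{Φ₀} = (1 + κ) L_w`. -/
def LPhi : ℝ := (1 + c.κ) * c.Lw

/-- `C_w = 5 L_w² [Λ₁ (3 Θ_w + 1) + 3 σ_w²]`. -/
def Cw : ℝ := 5 * c.Lw ^ 2 * (c.Λ1 * (3 * c.Θw + 1) + 3 * c.σw ^ 2)

/-- `C_u = (L_u² / 2) [Λ̂₁ (3 Θ_u + 2) + 3 σ_u²]`. -/
def Cu : ℝ := c.Lu ^ 2 / 2 * (c.dΛ1 * (3 * c.Θu + 2) + 3 * c.σu ^ 2)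

/-- The largest admissible learning rate. -/
def ηbar : ℝ :=
  min (1 / (60 * c.κ ^ 2 * c.Lu))
  (min (1 / √(10 * c.Λ0 * c.Lw ^ 2 * (3 * c.Θw + 1)))
  (min (2 * √c.Lu / (c.κ * √(15 * (4 * c.Lu ^ 2 + c.μψ ^ 2))))
  (min (√c.Lu / (15 * c.κ * √(2 * c.Lu ^ 3 * c.dΛ0 * (3 * c.Θu + 2) + c.μψ ^ 2)))
    (1 / (4 * c.LPhi + c.Lw + c.Lf)))))

/-- The ascent learning rate `η̂ = 15 κ² η` that belongs to the descent learning rate `η`. -/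
def ηhat (η : ℝ) : ℝ := 15 * c.κ ^ 2 * η

end Consts

/-! Assumptions. -/

section Assumptions

variable {n p q : ℕ}

/-- Assumptions on the problem that do not involve a learning rate. -/
structure Assumptions (c : Consts) (P : Problem n p q) : Prop where
  /-- the upper-level problem is bounded below -/
  bddBelow : ⊥ < P.PsiStar
  /-- `f` is proper, closed and convex -/
  convex_f : ProperClosedStronglyConvex 0 P.f
  /-- `h` is proper, closed and `μ_h`-strongly convex -/
  convex_h : ProperClosedStronglyConvex c.μh P.h
  /-- the domain of `h` is bounded -/
  dom_h : ∃ M : ℝ, ∀ u ∈ effDom P.h, ‖u‖ ≤ M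
  /-- `H_i` is differentiable in `(w, u)` -/
  diff : ∀ i, Differentiable ℝ (fun z : Euc p × Euc q => P.H i z.1 z.2)
  /-- `H_i(w, ·)` is `μ_H`-strongly concave -/
  concave : ∀ i w, StrongConcaveOn Set.univ c.μH (P.H i w)
  /-- the full gradient of `H_i` is `(L_w, L_u)`-Lipschitz -/
  lipschitz : ∀ i w u w' u',
    ‖P.gradW i w u - P.gradW i w' u'‖ ^ 2 + ‖P.gradU i w u - P.gradU i w' u'‖ ^ 2 ≤
      c.Lw ^ 2 * ‖w - w'‖ ^ 2 + c.Lu ^ 2 * ‖u - u'‖ ^ 2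
  /-- bounded variance of the gradients in `w` -/
  variance_w : ∀ w u, (1 / (n : ℝ)) * ∑ i, ‖P.gradW i w u - P.avgGradW w u‖ ^ 2 ≤
    c.Θw * ‖P.avgGradW w u‖ ^ 2 + c.σw ^ 2
  /-- bounded variance of the gradients in `u` -/
  variance_u : ∀ w u, (1 / (n : ℝ)) * ∑ i, ‖P.gradU i w u - P.avgGradU w u‖ ^ 2 ≤
    c.Θu * ‖P.avgGradU w u‖ ^ 2 + c.σu ^ 2
  /-- quadratic upper bound for `f` -/
  upper_f : ∀ x ∈ effDom P.f, ∀ y ∈ effDom P.f, ∀ s, IsSubgradient P.f x s →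
    realPart P.f y ≤ realPart P.f x + ⟪s, y - x⟫_ℝ + c.Lf / 2 * ‖y - x‖ ^ 2

/-- The hyper-gradient is controlled by the gradient mapping `𝓖_η` at the learning rate `η`. -/
def PrimalGradMapBound (c : Consts) (P : Problem n p q) (η : ℝ) : Prop :=
  ∀ w ∈ effDom P.Phi, ‖P.gradPhi w‖ ^ 2 ≤ c.Λ0 * ‖P.gradMap η w‖ ^ 2 + c.Λ1

/-- `∇_u H` is controlled by the gradient mapping of `-H(w, ·) + h` at the learning rate `η`. -/
def DualGradMapBound (c : Consts) (P : Problem n p q) (η : ℝ) : Prop :=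
  ∀ w ∈ effDom P.f, ∀ u ∈ effDom P.h,
    ‖P.avgGradU w u‖ ^ 2 ≤ c.dΛ0 * ‖P.dualGradMap η w u‖ ^ 2 + c.dΛ1

end Assumptions

/-! Programs that access the problem only through four oracles, and their query counts. -/

/-- Programs with result in `α` that may query `∇_w H_i`, `∇_u H_i`, `prox_{ηf}` and
`prox_{ηh}`; `k` is the continuation that receives the answer. -/
inductive Prog (n p q : ℕ) (α : Type) : Type
  | ret (a : α) : Prog n p q α
  | gradW (i : Fin n) (w : Euc p) (u : Euc q) (k : Euc p → Prog n p q α) : Prog n p q α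
  | gradU (i : Fin n) (w : Euc p) (u : Euc q) (k : Euc q → Prog n p q α) : Prog n p q α
  | proxF (η : ℝ) (w : Euc p) (k : Euc p → Prog n p q α) : Prog n p q α
  | proxH (η : ℝ) (u : Euc q) (k : Euc q → Prog n p q α) : Prog n p q α

/-- Numbers of evaluations of the four oracles. -/
structure QueryCount where
  gradW : ℕ
  gradU : ℕ
  proxF : ℕ
  proxH : ℕ

namespace Prog

variable {n p q : ℕ} {α β : Type}

/-- Sequential composition. -/
def bind : Prog n p q α → (α → Prog n p q β) → Prog n p q β
  | ret a, g => g a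
  | gradW i w u k, g => gradW i w u (fun x => (k x).bind g)
  | gradU i w u k, g => gradU i w u (fun x => (k x).bind g)
  | proxF η w k, g => proxF η w (fun x => (k x).bind g)
  | proxH η u k, g => proxH η u (fun x => (k x).bind g)

/-- The result of a program run on the problem `P`. -/
def eval (P : Problem n p q) : Prog n p q α → α
  | ret a => a
  | gradW i w u k => (k (P.gradW i w u)).eval P
  | gradU i w u k => (k (P.gradU i w u)).eval P
  | proxF η w k => (k (prox P.f η w)).eval P
  | proxH η u k => (k (prox P.h η u)).eval P

/-- The numbers of oracle evaluations made by a program run on the problem `P`. -/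
def count (P : Problem n p q) : Prog n p q α → QueryCount
  | ret _ => ⟨0, 0, 0, 0⟩
  | gradW i w u k =>
    let c := (k (P.gradW i w u)).count P
    { c with gradW := c.gradW + 1 }
  | gradU i w u k =>
    let c := (k (P.gradU i w u)).count P
    { c with gradU := c.gradU + 1 }
  | proxF η w k =>
    let c := (k (prox P.f η w)).count P
    { c with proxF := c.proxF + 1 }
  | proxH η u k =>
    let c := (k (prox P.h η u)).count P
    { c with proxH := c.proxH + 1 }

end Prog

/-! The alternating shuffling proximal gradient algorithm, full-shuffling variant with one
ascent epoch per iteration. -/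

section Algorithm

variable {n p q : ℕ}

/-- Components in the order `π(1), …, π(n)`. -/
def order (π : Equiv.Perm (Fin n)) : List (Fin n) := (List.finRange n).map π

/-- The steps `u ← u + a ∇_u H_i(w, u)` for `i` running through a list. -/
def ascentLoop (a : ℝ) (w : Euc p) : List (Fin n) → Euc q → Prog n p q (Euc q)
  | [], u => .ret u
  | i :: is, u => .gradU i w u (fun g => ascentLoop a w is (u + a • g))

/-- The steps `w ← w - a ∇_w H_i(w, u)` for `i` running through a list. -/
def descentLoop (a : ℝ) (u : Euc q) : List (Fin n) → Euc p → Prog n p q (Euc p)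
  | [], w => .ret w
  | i :: is, w => .gradW i w u (fun g => descentLoop a u is (w - a • g))

/-- One iteration: a shuffling ascent epoch in `u` in the order `π` followed by `prox_{η̂h}`,
then a shuffling descent epoch in `w` in the order `π'` followed by `prox_{ηf}`. -/
def epoch (η ηh : ℝ) (π π' : Equiv.Perm (Fin n)) (z : Euc p × Euc q) :
    Prog n p q (Euc p × Euc q) :=
  (ascentLoop (ηh / n) z.1 (order π) z.2).bind fun v =>
    .proxH ηh v fun u =>
      (descentLoop (η / n) u (order π') z.1).bind fun v' =>
        .proxF η v' fun w => .ret (w, u)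

/-- The algorithm with `T` iterations; its result is the pair `(w̃_T, ũ_T)`. -/
def algorithm (η ηh : ℝ) (π π' : ℕ → Equiv.Perm (Fin n)) (w₀ : Euc p) (u₀ : Euc q) :
    ℕ → Prog n p q (Euc p × Euc q)
  | 0 => .ret (w₀, u₀)
  | t + 1 => (algorithm η ηh π π' w₀ u₀ t).bind (epoch η ηh (π t) (π' t))

/-- The iterate `w̃_t` on the problem `P`, with learning rates `η` and `η̂ = 15 κ² η`. -/
def wIter (c : Consts) (P : Problem n p q) (η : ℝ) (π π' : ℕ → Equiv.Perm (Fin n))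
    (w₀ : Euc p) (u₀ : Euc q) (t : ℕ) : Euc p :=
  ((algorithm η (c.ηhat η) π π' w₀ u₀ t).eval P).1

/-- `(1/(T+1)) ∑_{t=0}^T ‖𝓖_η(w̃_t)‖²`. -/
def avgSqGradMap (c : Consts) (P : Problem n p q) (η : ℝ) (π π' : ℕ → Equiv.Perm (Fin n))
    (w₀ : Euc p) (u₀ : Euc q) (T : ℕ) : ℝ :=
  (1 / ((T : ℝ) + 1)) *
    ∑ t ∈ Finset.range (T + 1), ‖P.gradMap η (wIter c P η π π' w₀ u₀ t)‖ ^ 2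

/-- `Ψ₀(w) - Ψ₀⋆`. -/
def primalGap (P : Problem n p q) (w : Euc p) : ℝ := (P.Psi w).toReal - P.PsiStar.toReal

/-- `Ψ₀(w) - 𝓛(w, u)`. -/
def dualGap (P : Problem n p q) (w : Euc p) (u : Euc q) : ℝ :=
  (P.Psi w).toReal - (P.lagr w u).toReal

end Algorithm

end

end MinimaxShuffling

namespace MinimaxShuffling

/-! ### Convex analysis: quadratic growth, smooth functions, proximal steps. -/

section ConvexAnalysis

/-! Let u*(w) be the maximizer of H(w,·) - h and μ = `c.μψ`. The proof follows the Lyapunov function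
Ψ₀(w) + (μ/4)‖u - u*(w)‖² (`potential`): one iteration lowers it by (η/4)‖𝓖_η(w)‖² up to noise of
third order in the learning rates (`potential_step`), and telescoping gives the convergence bound.

Smoothness of Φ₀ is a Danskin argument that never differentiates u*. Quadratic growth of the dual
objective around u*(w), together with a bound for mixed second differences of H, makes u*
κ-Lipschitz; then Φ₀ is caught between two quadratics with slope ∇_w H(w, u*(w)) (`phi_le`,
`le_phi`).

The permutations are arbitrary, so no unbiasedness is available. An epoch is read as one step along
the average of the gradients at its inner iterates. Its error is governed by the mean square
distance S of these iterates from the starting point, and S is bounded by a small multiple of itself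
plus the variance and the mean gradient at a reference point (`exists_shuffle_path_deviation`). In
the descent epoch the reference is the starting point, and the growth condition on ∇Φ₀ trades the
mean gradient for 𝓖_η. In the ascent epoch it is u*(w), where the dual gradient mapping vanishes, so
the growth condition leaves only the constant Λ̂₁.

The ascent epoch divides ‖u - u*(w)‖² by 1 + η̂μ/2 up to noise (`nextU_dist_le`). The descent epoch
loses (5/4)ηL_u²‖u - u*(w)‖² (`nextW_descent`) and displaces u* by at most κ times the primal step.
The ratio η̂ = 15κ²η lets the contraction and the spare quadratic term of the descent pay for both
losses. -/

theorem le_of_forall_le_add_mul {a b c : ℝ} (h : ∀ t : ℝ, 0 < t → t ≤ 1 → a ≤ b + t * c) :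
    a ≤ b := by
  have hlim : Filter.Tendsto (fun t : ℝ => b + t * c) (nhdsWithin 0 (Set.Ioi 0)) (nhds b) := by
    have : Filter.Tendsto (fun t : ℝ => b + t * c) (nhds 0) (nhds (b + 0 * c)) :=
      (Continuous.tendsto (by fun_prop) 0)
    simpa using this.mono_left nhdsWithin_le_nhds
  refine ge_of_tendsto hlim ?_
  filter_upwards [Ioc_mem_nhdsGT (zero_lt_one' ℝ)] with t ht using h t ht.1 ht.2

variable {E : Type*} [NormedAddCommGroup E]

theorem exists_forall_le_of_lowerSemicontinuous [ProperSpace E] {g : E → EReal}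
    (hg : LowerSemicontinuous g) (x₀ : E) (R : ℝ) (hR : ∀ y, R < ‖y - x₀‖ → g x₀ ≤ g y) :
    ∃ y, ∀ z, g y ≤ g z := by
  have hx₀ : x₀ ∈ Metric.closedBall x₀ (max R 0) := by simp
  obtain ⟨y, -, hy⟩ := LowerSemicontinuousOn.exists_isMinOn ⟨x₀, hx₀⟩
    (isCompact_closedBall x₀ (max R 0)) (hg.lowerSemicontinuousOn _)
  refine ⟨y, fun z => ?_⟩
  by_cases hz : z ∈ Metric.closedBall x₀ (max R 0)
  · exact hy hz
  · refine (hy hx₀).trans (hR z ?_)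
    rw [Metric.mem_closedBall, dist_eq_norm, not_le] at hz
    exact (le_max_left _ _).trans_lt hz

theorem lowerSemicontinuous_add_coe {g : E → EReal} (hg : LowerSemicontinuous g) {r : E → ℝ}
    (hr : Continuous r) : LowerSemicontinuous fun z => g z + ((r z : ℝ) : EReal) :=
  hg.add' (continuous_coe_real_ereal.comp hr).lowerSemicontinuous fun _ =>
    EReal.continuousAt_add (Or.inr (EReal.coe_ne_bot _)) (Or.inr (EReal.coe_ne_top _))

theorem eq_top_of_notMem_effDom {X : Type*} {g : X → EReal} {x : X} (hx : x ∉ effDom g) :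
    g x = ⊤ :=
  not_lt_top_iff.1 hx

variable [InnerProductSpace ℝ E]

/-- Compare y with the point t z + (1 - t) y, divide by t and let t tend to 0. -/
theorem StrongConvexOn.add_sq_le_of_forall_le {s : Set E} {m : ℝ} {φ : E → ℝ}
    (h : StrongConvexOn s m φ) {y z : E} (hy : y ∈ s) (hmin : ∀ z ∈ s, φ y ≤ φ z) (hz : z ∈ s) :
    φ y + m / 2 * ‖z - y‖ ^ 2 ≤ φ z := by
  refine le_of_forall_le_add_mul (c := m / 2 * ‖z - y‖ ^ 2) fun t ht ht1 => ?_
  have h1 := h.2 hz hy ht.le (sub_nonneg.2 ht1) (by ring)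
  have h2 := hmin _ (h.1 hz hy ht.le (sub_nonneg.2 ht1) (by ring))
  simp only [smul_eq_mul] at h1
  have h3 : t * (φ y + m / 2 * ‖z - y‖ ^ 2) ≤ t * (φ z + t * (m / 2 * ‖z - y‖ ^ 2)) := by
    nlinarith
  exact le_of_mul_le_mul_left h3 ht

theorem strongConvexOn_sq_div {s : Set E} (hs : Convex ℝ s) (η : ℝ) (x : E) :
    StrongConvexOn s (1 / η) fun z => ‖z - x‖ ^ 2 / (2 * η) := by
  refine ⟨hs, fun y _ z _ a b _ _ hab => le_of_eq ?_⟩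
  have h1 : a • y + b • z - x = a • (y - x) + b • (z - x) := by
    obtain rfl : b = 1 - a := by linarith
    module
  have h2 : y - z = (y - x) - (z - x) := by abel
  simp only [h1, h2, smul_eq_mul]
  generalize y - x = p
  generalize z - x = q
  have e1 := norm_add_sq_real (a • p) (b • q)
  have e2 := norm_sub_sq_real p q
  rw [norm_smul, norm_smul, inner_smul_left, inner_smul_right, mul_pow, mul_pow, Real.norm_eq_abs,
    Real.norm_eq_abs, sq_abs, sq_abs] at e1
  rw [e1, e2]
  obtain rfl : b = 1 - a := by linarith
  simp only [conj_trivial]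
  ring

theorem StrongConvexOn.add {s : Set E} {m m' : ℝ} {φ ψ : E → ℝ}
    (h : StrongConvexOn s m φ) (h' : StrongConvexOn s m' ψ) :
    StrongConvexOn s (m + m') (φ + ψ) := by
  have := UniformConvexOn.add h h'
  unfold StrongConvexOn
  convert this using 2 with r
  simp only [Pi.add_apply]
  ring

/-! Smooth functions. -/

section Smooth

variable [CompleteSpace E] {φ : E → ℝ} {g : E → E} {L : ℝ}

theorem le_add_inner_add_sq_of_gradient_lipschitz (hφ : ∀ x, HasGradientAt φ (g x) x)
    (hL : ∀ x y, ‖g x - g y‖ ≤ L * ‖x - y‖) (x y : E) :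
    φ y ≤ φ x + ⟪g x, y - x⟫_ℝ + L / 2 * ‖y - x‖ ^ 2 := by
  set v := y - x with hv
  -- φ along the segment minus its claimed quadratic majorant; the Lipschitz bound makes its
  -- derivative nonpositive.
  let G : ℝ → ℝ := fun t => φ (x + t • v) - t * ⟪g x, v⟫_ℝ - L / 2 * t ^ 2 * ‖v‖ ^ 2
  have hd : ∀ t : ℝ, HasDerivAt G
      (⟪g (x + t • v), v⟫_ℝ - ⟪g x, v⟫_ℝ - L * t * ‖v‖ ^ 2) t := by
    intro t
    have h1 : HasDerivAt (fun t : ℝ => x + t • v) v t := by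
      simpa using ((hasDerivAt_id t).smul_const v).const_add x
    have h2 := (hφ (x + t • v)).hasFDerivAt.comp_hasDerivAt t h1
    have h3 : HasDerivAt (fun t : ℝ => t * ⟪g x, v⟫_ℝ) (⟪g x, v⟫_ℝ) t := by
      simpa using (hasDerivAt_id t).mul_const (⟪g x, v⟫_ℝ)
    have h4 : HasDerivAt (fun t : ℝ => L / 2 * t ^ 2 * ‖v‖ ^ 2) (L * t * ‖v‖ ^ 2) t := by
      have := ((hasDerivAt_pow 2 t).const_mul (L / 2)).mul_const (‖v‖ ^ 2)
      refine this.congr_deriv ?_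
      push_cast
      ring
    exact ((h2.sub h3).sub h4).congr_deriv (by simp)
  have hanti : AntitoneOn G (Set.Icc 0 1) := by
    refine antitoneOn_of_deriv_nonpos (convex_Icc 0 1)
      (fun t _ => (hd t).continuousAt.continuousWithinAt)
      (fun t _ => (hd t).differentiableAt.differentiableWithinAt) fun t ht => ?_
    rw [interior_Icc] at ht
    rw [(hd t).deriv, ← inner_sub_left]
    have h1 := real_inner_le_norm (g (x + t • v) - g x) v
    have h2 := hL (x + t • v) x
    rw [add_sub_cancel_left, norm_smul, Real.norm_eq_abs, abs_of_pos ht.1] at h2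
    nlinarith [mul_le_mul_of_nonneg_right h2 (norm_nonneg v)]
  have := hanti (Set.left_mem_Icc.2 zero_le_one) (Set.right_mem_Icc.2 zero_le_one) zero_le_one
  simp only [G, one_smul, zero_smul, add_zero, hv, add_sub_cancel] at this
  rw [hv]
  linarith

theorem add_inner_sub_sq_le_of_gradient_lipschitz (hφ : ∀ x, HasGradientAt φ (g x) x)
    (hL : ∀ x y, ‖g x - g y‖ ≤ L * ‖x - y‖) (x y : E) :
    φ x + ⟪g x, y - x⟫_ℝ - L / 2 * ‖y - x‖ ^ 2 ≤ φ y := by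
  have h1 : ∀ x, HasGradientAt (fun z => - φ z) (- g x) x := fun x => by
    have := (hφ x).hasFDerivAt.neg
    rw [hasGradientAt_iff_hasFDerivAt, map_neg]
    exact this
  have := le_add_inner_add_sq_of_gradient_lipschitz h1 (L := L)
    (fun x y => by rw [neg_sub_neg, norm_sub_rev]; exact hL x y) x y
  rw [inner_neg_left] at this
  linarith

/-- Convexity bounds φ from above near x on the segment to y, smoothness bounds it from below; the
quadratic error disappears after dividing by t. -/
theorem add_inner_le_of_convexOn (hφ : ∀ x, HasGradientAt φ (g x) x)
    (hL : ∀ x y, ‖g x - g y‖ ≤ L * ‖x - y‖) (hc : ConvexOn ℝ Set.univ φ) (x y : E) :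
    φ x + ⟪g x, y - x⟫_ℝ ≤ φ y := by
  refine le_of_forall_le_add_mul (c := L / 2 * ‖y - x‖ ^ 2) fun t ht ht1 => ?_
  have h1 := hc.2 (Set.mem_univ y) (Set.mem_univ x) ht.le (sub_nonneg.2 ht1) (by ring)
  have h2 := add_inner_sub_sq_le_of_gradient_lipschitz hφ hL x (t • y + (1 - t) • x)
  have h3 : t • y + (1 - t) • x - x = t • (y - x) := by module
  rw [h3, inner_smul_right, norm_smul, Real.norm_eq_abs, abs_of_pos ht] at h2
  simp only [smul_eq_mul] at h1
  have h4 : t * (φ x + ⟪g x, y - x⟫_ℝ) ≤ t * (φ y + t * (L / 2 * ‖y - x‖ ^ 2)) := by nlinarith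
  exact le_of_mul_le_mul_left h4 ht

theorem norm_gradient_sub_sq_le_of_convexOn (hφ : ∀ x, HasGradientAt φ (g x) x) (hLpos : 0 < L)
    (hL : ∀ x y, ‖g x - g y‖ ≤ L * ‖x - y‖) (hc : ConvexOn ℝ Set.univ φ) (x y : E) :
    ‖g y - g x‖ ^ 2 ≤ 2 * L * (φ y - φ x - ⟪g x, y - x⟫_ℝ) := by
  -- A gradient step of length 1/L from y for φ - ⟪g x, ·⟫, a convex function minimized at x; its
  -- guaranteed decrease cannot exceed the gap between y and x.
  set z := y - (1 / L) • (g y - g x) with hz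
  have h1 := add_inner_le_of_convexOn hφ hL hc x z
  have h2 := le_add_inner_add_sq_of_gradient_lipschitz hφ hL y z
  have e1 : z - y = - ((1 / L) • (g y - g x)) := by rw [hz]; abel
  have e2 : z - x = (y - x) - (1 / L) • (g y - g x) := by rw [hz]; abel
  rw [e2, inner_sub_right, inner_smul_right] at h1
  rw [e1, inner_neg_right, inner_smul_right, norm_neg, norm_smul, mul_pow, Real.norm_eq_abs,
    sq_abs] at h2
  have e3 : ⟪g y, g y - g x⟫_ℝ - ⟪g x, g y - g x⟫_ℝ = ‖g y - g x‖ ^ 2 := by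
    rw [← inner_sub_left, real_inner_self_eq_norm_sq]
  have e4 : L / 2 * ((1 / L) ^ 2 * ‖g y - g x‖ ^ 2) = 1 / L * ‖g y - g x‖ ^ 2 / 2 := by
    field_simp
  have e5 : 1 / L * ‖g y - g x‖ ^ 2 ≤ 2 * (φ y - φ x - ⟪g x, y - x⟫_ℝ) := by
    rw [e4] at h2
    have e6 : 1 / L * ‖g y - g x‖ ^ 2 =
        1 / L * ⟪g y, g y - g x⟫_ℝ - 1 / L * ⟪g x, g y - g x⟫_ℝ := by rw [← e3, mul_sub]
    linarith
  rw [one_div_mul_eq_div, div_le_iff₀ hLpos] at e5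
  linarith

end Smooth

/-! Proximal operators. -/

section Prox

variable {m η : ℝ} {g : E → EReal}

theorem ProperClosedStronglyConvex.coe_realPart (hg : ProperClosedStronglyConvex m g) {x : E}
    (hx : x ∈ effDom g) : ((realPart g x : ℝ) : EReal) = g x :=
  EReal.coe_toReal (ne_of_lt hx) (hg.ne_bot x)

theorem IsProx.mem_effDom (hg : ProperClosedStronglyConvex m g) {x y : E}
    (h : IsProx g η x y) : y ∈ effDom g := by
  obtain ⟨z, hz⟩ := hg.nonempty_dom
  have h1 := h z
  by_contra hy
  rw [eq_top_of_notMem_effDom hy, EReal.top_add_coe, ← hg.coe_realPart hz,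
    ← EReal.coe_add] at h1
  exact absurd h1 (not_le.2 (EReal.coe_lt_top _))

theorem IsProx.add_sq_le (hg : ProperClosedStronglyConvex m g) {x y z : E}
    (h : IsProx g η x y) (hz : z ∈ effDom g) :
    realPart g y + ‖y - x‖ ^ 2 / (2 * η) + (m + 1 / η) / 2 * ‖z - y‖ ^ 2 ≤
      realPart g z + ‖z - x‖ ^ 2 / (2 * η) := by
  have hy := IsProx.mem_effDom hg h
  refine StrongConvexOn.add_sq_le_of_forall_le
    (StrongConvexOn.add hg.strongConvex (strongConvexOn_sq_div hg.strongConvex.1 η x)) hy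
    (fun z hz => ?_) hz
  have := h z
  rw [← hg.coe_realPart hz, ← hg.coe_realPart hy] at this
  exact_mod_cast this

/-- No global lower bound for `g` is given. Its minimum over a unit ball, propagated along rays by
convexity, shows that `g` decreases at most linearly, and the quadratic term wins far away. -/
theorem ProperClosedStronglyConvex.exists_isProx [ProperSpace E]
    (hg : ProperClosedStronglyConvex m g) (hm : 0 ≤ m) (hη : 0 < η) (x : E) :
    ∃ y, IsProx g η x y := by
  obtain ⟨x₀, hx₀⟩ := hg.nonempty_dom
  obtain ⟨y₀, -, hy₀⟩ := LowerSemicontinuousOn.exists_isMinOn (s := Metric.closedBall x₀ 1)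
    ⟨x₀, by simp⟩ (isCompact_closedBall x₀ 1) (hg.closed.lowerSemicontinuousOn _)
  have hle : g y₀ ≤ g x₀ := hy₀ (show x₀ ∈ Metric.closedBall x₀ 1 by simp)
  have hy₀d : y₀ ∈ effDom g := lt_of_le_of_lt hle hx₀
  set b := ‖x₀ - x‖ with hb
  set c := realPart g x₀ - realPart g y₀ with hc
  have hlsc := lowerSemicontinuous_add_coe hg.closed
    (r := fun z => ‖z - x‖ ^ 2 / (2 * η)) (by fun_prop)
  -- With t = ‖y - x₀‖, convexity gives g y ≥ g x₀ - t c, while the quadratic term grows by at least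
  -- t (t - 2b) / (2η); this covers t c as soon as t ≥ 2b + 2ηc. The 1 keeps y outside the unit
  -- ball.
  refine exists_forall_le_of_lowerSemicontinuous hlsc x₀ (max 1 (2 * b + 2 * η * c)) fun y hy => ?_
  obtain ⟨h1, h2⟩ := max_lt_iff.1 hy
  by_cases hyd : y ∈ effDom g
  · set t := ‖y - x₀‖ with ht
    have ht0 : 0 < t := one_pos.trans h1
    have hinv : t⁻¹ ≤ 1 := inv_le_one_of_one_le₀ h1.le
    have hconv : ConvexOn ℝ (effDom g) (realPart g) :=
      strongConvexOn_zero.1 (StrongConvexOn.mono hm hg.strongConvex)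
    have hmem := hg.strongConvex.1 hyd hx₀ (inv_nonneg.2 ht0.le) (sub_nonneg.2 hinv)
      (add_sub_cancel _ _)
    have h3 := hconv.2 hyd hx₀ (inv_nonneg.2 ht0.le) (sub_nonneg.2 hinv) (add_sub_cancel _ _)
    have h4 : g y₀ ≤ g (t⁻¹ • y + (1 - t⁻¹) • x₀) := by
      refine hy₀ ?_
      have : t⁻¹ • y + (1 - t⁻¹) • x₀ - x₀ = t⁻¹ • (y - x₀) := by module
      simp only [Metric.mem_closedBall, dist_eq_norm, this, norm_smul, norm_inv,
        Real.norm_eq_abs, abs_of_pos ht0, ← ht]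
      rw [inv_mul_cancel₀ ht0.ne']
    rw [← hg.coe_realPart hy₀d, ← hg.coe_realPart hmem, EReal.coe_le_coe_iff] at h4
    have h5 := h4.trans h3
    simp only [smul_eq_mul] at h5
    have h6 : t * realPart g y₀ ≤ realPart g y + (t - 1) * realPart g x₀ := by
      have := mul_le_mul_of_nonneg_left h5 ht0.le
      calc _ ≤ _ := this
        _ = _ := by field_simp
    have h7 : t - b ≤ ‖y - x‖ := by
      have : t ≤ ‖y - x‖ + ‖x - x₀‖ := norm_sub_le_norm_sub_add_norm_sub y x x₀
      rw [norm_sub_rev x x₀] at this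
      linarith
    have hb0 : 0 ≤ b := norm_nonneg _
    have h8 : (t - b) ^ 2 - b ^ 2 ≤ ‖y - x‖ ^ 2 - b ^ 2 := by
      have hc0 : 0 ≤ c := by
        rw [← hg.coe_realPart hy₀d, ← hg.coe_realPart hx₀, EReal.coe_le_coe_iff] at hle
        linarith
      have : 0 ≤ 2 * η * c := by positivity
      gcongr
      linarith
    have h9 : 2 * η * (t * c) ≤ ‖y - x‖ ^ 2 - b ^ 2 := by nlinarith
    have h10 : t * c ≤ ‖y - x‖ ^ 2 / (2 * η) - b ^ 2 / (2 * η) := by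
      rw [← sub_div, le_div_iff₀ (by positivity)]
      linarith
    rw [← hg.coe_realPart hx₀, ← hg.coe_realPart hyd, ← EReal.coe_add, ← EReal.coe_add,
      EReal.coe_le_coe_iff]
    rw [hc] at h10
    linarith
  · rw [eq_top_of_notMem_effDom hyd, EReal.top_add_coe]
    exact le_top

theorem ProperClosedStronglyConvex.isProx_prox [ProperSpace E]
    (hg : ProperClosedStronglyConvex m g) (hm : 0 ≤ m) (hη : 0 < η) (x : E) :
    IsProx g η x (prox g η x) :=
  Classical.epsilon_spec (hg.exists_isProx hm hη x)

theorem IsProx.eq (hg : ProperClosedStronglyConvex m g) (hm : 0 ≤ m) (hη : 0 < η) {x y z : E}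
    (hy : IsProx g η x y) (hz : IsProx g η x z) : y = z := by
  have h1 := hy.add_sq_le hg (hz.mem_effDom hg)
  have h2 := hz.add_sq_le hg (hy.mem_effDom hg)
  rw [norm_sub_rev y z] at h2
  have h3 : (m + 1 / η) / 2 * ‖z - y‖ ^ 2 ≤ 0 := by linarith
  have h4 : 0 < (m + 1 / η) / 2 := by positivity
  have h5 : ‖z - y‖ ^ 2 ≤ 0 := by
    by_contra hcon
    exact absurd h3 (not_le.2 (mul_pos h4 (not_le.1 hcon)))
  have h6 : ‖z - y‖ = 0 := by
    have := sq_nonneg ‖z - y‖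
    exact pow_eq_zero_iff two_ne_zero |>.1 (le_antisymm h5 this)
  exact (sub_eq_zero.1 (norm_eq_zero.1 h6)).symm

/-- The three-point inequality for the proximal step `y` from `x` in the direction `-v`. -/
theorem IsProx.three_point (hg : ProperClosedStronglyConvex m g) (hη : 0 < η) {x v y z : E}
    (hy : IsProx g η (x - η • v) y) (hz : z ∈ effDom g) :
    realPart g y + ⟪v, y - z⟫_ℝ + ‖y - x‖ ^ 2 / (2 * η) + (m + 1 / η) / 2 * ‖z - y‖ ^ 2 ≤
      realPart g z + ‖z - x‖ ^ 2 / (2 * η) := by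
  have h := hy.add_sq_le hg hz
  have e : ∀ w : E, ‖w - (x - η • v)‖ ^ 2 / (2 * η) =
      ‖w - x‖ ^ 2 / (2 * η) + ⟪v, w - x⟫_ℝ + η * ‖v‖ ^ 2 / 2 := by
    intro w
    have : w - (x - η • v) = (w - x) + η • v := by abel
    rw [this, norm_add_sq_real, inner_smul_right, norm_smul, mul_pow, Real.norm_eq_abs, sq_abs,
      real_inner_comm]
    field_simp
  rw [e, e] at h
  have e2 : ⟪v, y - z⟫_ℝ = ⟪v, y - x⟫_ℝ - ⟪v, z - x⟫_ℝ := by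
    rw [← inner_sub_right]; congr 1; abel
  rw [e2]
  linarith

end Prox

end ConvexAnalysis

/-! ### Means of vectors and of reals over the components. -/

section Averages

variable {E : Type*} [NormedAddCommGroup E]

theorem norm_sum_sq_le_card_mul {ι : Type*} (s : Finset ι) (v : ι → E) :
    ‖∑ i ∈ s, v i‖ ^ 2 ≤ s.card * ∑ i ∈ s, ‖v i‖ ^ 2 :=
  (pow_le_pow_left₀ (norm_nonneg _) (norm_sum_le s v) 2).trans sq_sum_le_card_mul_sum_sq

theorem norm_average_sq_le [InnerProductSpace ℝ E] {n : ℕ} (hn : 0 < n) (v : Fin n → E) :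
    ‖(1 / (n : ℝ)) • ∑ i, v i‖ ^ 2 ≤ (1 / (n : ℝ)) * ∑ i, ‖v i‖ ^ 2 := by
  have hn' : (0 : ℝ) < n := Nat.cast_pos.2 hn
  have h := norm_sum_sq_le_card_mul Finset.univ v
  rw [Finset.card_univ, Fintype.card_fin] at h
  rw [norm_smul, mul_pow, Real.norm_eq_abs, sq_abs]
  calc (1 / (n : ℝ)) ^ 2 * ‖∑ i, v i‖ ^ 2 ≤ (1 / (n : ℝ)) ^ 2 * (n * ∑ i, ‖v i‖ ^ 2) := by gcongr
    _ = _ := by field_simp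

theorem average_const {n : ℕ} (hn : 0 < n) (a : ℝ) : (1 / (n : ℝ)) * ∑ _i : Fin n, a = a := by
  have hn' : (n : ℝ) ≠ 0 := Nat.cast_ne_zero.2 hn.ne'
  rw [Finset.sum_const, Finset.card_univ, Fintype.card_fin, nsmul_eq_mul]
  field_simp

theorem average_le_average {n : ℕ} {a b : Fin n → ℝ} (h : ∀ i, a i ≤ b i) :
    (1 / (n : ℝ)) * ∑ i, a i ≤ (1 / (n : ℝ)) * ∑ i, b i :=
  mul_le_mul_of_nonneg_left (Finset.sum_le_sum fun i _ => h i) (by positivity)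

end Averages

/-- A maximizer of `H(w, ·) - h`. -/
noncomputable def Problem.argmaxU {n p q : ℕ} (P : Problem n p q) (w : Euc p) : Euc q :=
  Classical.epsilon fun u => u ∈ effDom P.h ∧
    ∀ z ∈ effDom P.h, realPart P.h u - P.avgH w u ≤ realPart P.h z - P.avgH w z

/-! ### The dual maximizer, its Lipschitz dependence on w, and the gradient of Φ₀. -/

section Gradients

variable {n p q : ℕ} {c : Consts} {P : Problem n p q}

theorem Assumptions.hasGradientAt_H_left (hA : Assumptions c P) (i : Fin n) (w : Euc p)
    (u : Euc q) : HasGradientAt (fun w' => P.H i w' u) (P.gradW i w u) w := by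
  have : DifferentiableAt ℝ (fun w' => P.H i w' u) w :=
    ((hA.diff i) (w, u)).comp w (f := fun w' : Euc p => (w', u)) (by fun_prop)
  exact this.hasGradientAt

theorem Assumptions.hasGradientAt_H_right (hA : Assumptions c P) (i : Fin n) (w : Euc p)
    (u : Euc q) : HasGradientAt (fun u' => P.H i w u') (P.gradU i w u) u := by
  have : DifferentiableAt ℝ (fun u' => P.H i w u') u :=
    ((hA.diff i) (w, u)).comp u (f := fun u' : Euc q => (w, u')) (by fun_prop)
  exact this.hasGradientAt

theorem hasGradientAt_average {E : Type*} [NormedAddCommGroup E] [InnerProductSpace ℝ E]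
    [CompleteSpace E] {F : Fin n → E → ℝ} {G : Fin n → E} {x : E}
    (h : ∀ i, HasGradientAt (F i) (G i) x) :
    HasGradientAt (fun y => (1 / (n : ℝ)) * ∑ i, F i y) ((1 / (n : ℝ)) • ∑ i, G i) x := by
  rw [hasGradientAt_iff_hasFDerivAt, map_smul, map_sum]
  exact (HasFDerivAt.fun_sum fun i _ => (h i).hasFDerivAt).const_mul _

theorem Assumptions.avgGradW_eq (hA : Assumptions c P) (w : Euc p) (u : Euc q) :
    P.avgGradW w u = (1 / (n : ℝ)) • ∑ i, P.gradW i w u :=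
  (hasGradientAt_average fun i => hA.hasGradientAt_H_left i w u).gradient

theorem Assumptions.avgGradU_eq (hA : Assumptions c P) (w : Euc p) (u : Euc q) :
    P.avgGradU w u = (1 / (n : ℝ)) • ∑ i, P.gradU i w u :=
  (hasGradientAt_average fun i => hA.hasGradientAt_H_right i w u).gradient

theorem Assumptions.hasGradientAt_avgH_left (hA : Assumptions c P) (w : Euc p) (u : Euc q) :
    HasGradientAt (fun w' => P.avgH w' u) (P.avgGradW w u) w := by
  rw [hA.avgGradW_eq]
  exact hasGradientAt_average fun i => hA.hasGradientAt_H_left i w u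

theorem Assumptions.hasGradientAt_avgH_right (hA : Assumptions c P) (w : Euc p) (u : Euc q) :
    HasGradientAt (fun u' => P.avgH w u') (P.avgGradU w u) u := by
  rw [hA.avgGradU_eq]
  exact hasGradientAt_average fun i => hA.hasGradientAt_H_right i w u

theorem Assumptions.gradW_sub_left (hA : Assumptions c P) (hc : c.Valid) (i : Fin n)
    (w w' : Euc p) (u : Euc q) : ‖P.gradW i w u - P.gradW i w' u‖ ≤ c.Lw * ‖w - w'‖ := by
  have h := hA.lipschitz i w u w' u
  rw [sub_self u, norm_zero] at h
  refine le_of_sq_le_sq ?_ (mul_nonneg hc.Lw_pos.le (norm_nonneg _))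
  nlinarith [sq_nonneg ‖P.gradU i w u - P.gradU i w' u‖]

theorem Assumptions.gradU_sub_left (hA : Assumptions c P) (hc : c.Valid) (i : Fin n)
    (w w' : Euc p) (u : Euc q) : ‖P.gradU i w u - P.gradU i w' u‖ ≤ c.Lw * ‖w - w'‖ := by
  have h := hA.lipschitz i w u w' u
  rw [sub_self u, norm_zero] at h
  refine le_of_sq_le_sq ?_ (mul_nonneg hc.Lw_pos.le (norm_nonneg _))
  nlinarith [sq_nonneg ‖P.gradW i w u - P.gradW i w' u‖]

theorem Assumptions.gradW_sub_right (hA : Assumptions c P) (hc : c.Valid) (i : Fin n)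
    (w : Euc p) (u u' : Euc q) : ‖P.gradW i w u - P.gradW i w u'‖ ≤ c.Lu * ‖u - u'‖ := by
  have h := hA.lipschitz i w u w u'
  rw [sub_self w, norm_zero] at h
  refine le_of_sq_le_sq ?_ (mul_nonneg hc.Lu_pos.le (norm_nonneg _))
  nlinarith [sq_nonneg ‖P.gradU i w u - P.gradU i w u'‖]

theorem Assumptions.gradU_sub_right (hA : Assumptions c P) (hc : c.Valid) (i : Fin n)
    (w : Euc p) (u u' : Euc q) : ‖P.gradU i w u - P.gradU i w u'‖ ≤ c.Lu * ‖u - u'‖ := by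
  have h := hA.lipschitz i w u w u'
  rw [sub_self w, norm_zero] at h
  refine le_of_sq_le_sq ?_ (mul_nonneg hc.Lu_pos.le (norm_nonneg _))
  nlinarith [sq_nonneg ‖P.gradW i w u - P.gradW i w u'‖]

theorem norm_average_sub_average_le {E : Type*} [NormedAddCommGroup E] [InnerProductSpace ℝ E]
    (hn : 0 < n) {v v' : Fin n → E} {a : ℝ} (h : ∀ i, ‖v i - v' i‖ ≤ a) :
    ‖(1 / (n : ℝ)) • ∑ i, v i - (1 / (n : ℝ)) • ∑ i, v' i‖ ≤ a := by
  have hn' : (0 : ℝ) < n := Nat.cast_pos.2 hn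
  rw [← smul_sub, ← Finset.sum_sub_distrib, norm_smul, Real.norm_of_nonneg (by positivity)]
  calc 1 / (n : ℝ) * ‖∑ i, (v i - v' i)‖ ≤ 1 / (n : ℝ) * ∑ _i : Fin n, a := by
        gcongr
        exact (norm_sum_le _ _).trans (Finset.sum_le_sum fun i _ => h i)
    _ = a := average_const hn a

theorem Assumptions.avgGradW_sub_left (hA : Assumptions c P) (hc : c.Valid) (hn : 0 < n)
    (w w' : Euc p) (u : Euc q) : ‖P.avgGradW w u - P.avgGradW w' u‖ ≤ c.Lw * ‖w - w'‖ := by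
  rw [hA.avgGradW_eq, hA.avgGradW_eq]
  exact norm_average_sub_average_le hn fun i => hA.gradW_sub_left hc i w w' u

theorem Assumptions.avgGradU_sub_left (hA : Assumptions c P) (hc : c.Valid) (hn : 0 < n)
    (w w' : Euc p) (u : Euc q) : ‖P.avgGradU w u - P.avgGradU w' u‖ ≤ c.Lw * ‖w - w'‖ := by
  rw [hA.avgGradU_eq, hA.avgGradU_eq]
  exact norm_average_sub_average_le hn fun i => hA.gradU_sub_left hc i w w' u

theorem Assumptions.avgGradW_sub_right (hA : Assumptions c P) (hc : c.Valid) (hn : 0 < n)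
    (w : Euc p) (u u' : Euc q) : ‖P.avgGradW w u - P.avgGradW w u'‖ ≤ c.Lu * ‖u - u'‖ := by
  rw [hA.avgGradW_eq, hA.avgGradW_eq]
  exact norm_average_sub_average_le hn fun i => hA.gradW_sub_right hc i w u u'

theorem Assumptions.avgGradU_sub_right (hA : Assumptions c P) (hc : c.Valid) (hn : 0 < n)
    (w : Euc p) (u u' : Euc q) : ‖P.avgGradU w u - P.avgGradU w u'‖ ≤ c.Lu * ‖u - u'‖ := by
  rw [hA.avgGradU_eq, hA.avgGradU_eq]
  exact norm_average_sub_average_le hn fun i => hA.gradU_sub_right hc i w u u'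

theorem norm_sub_le_of_norm_gradient_le {E : Type*} [NormedAddCommGroup E]
    [InnerProductSpace ℝ E] [CompleteSpace E] {φ : E → ℝ} {g : E → E} {C : ℝ}
    (hφ : ∀ x, HasGradientAt φ (g x) x) (hg : ∀ x, ‖g x‖ ≤ C) (x y : E) :
    ‖φ y - φ x‖ ≤ C * ‖y - x‖ :=
  convex_univ.norm_image_sub_le_of_norm_hasFDerivWithin_le
    (fun z _ => (hφ z).hasFDerivAt.hasFDerivWithinAt)
    (fun z _ => by rw [LinearIsometryEquiv.norm_map]; exact hg z) (Set.mem_univ x) (Set.mem_univ y)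

theorem _root_.HasGradientAt.sub' {E : Type*} [NormedAddCommGroup E]
    [InnerProductSpace ℝ E] [CompleteSpace E] {φ ψ : E → ℝ} {a b x : E}
    (hφ : HasGradientAt φ a x) (hψ : HasGradientAt ψ b x) :
    HasGradientAt (fun z => φ z - ψ z) (a - b) x := by
  rw [hasGradientAt_iff_hasFDerivAt, map_sub]
  exact hφ.hasFDerivAt.sub hψ.hasFDerivAt

/-- Mixed second differences of `H` are bounded by both Lipschitz constants. -/
theorem Assumptions.mixed_difference_le (hA : Assumptions c P) (hc : c.Valid) (hn : 0 < n)
    (w w' : Euc p) (u u' : Euc q) :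
    P.avgH w' u' - P.avgH w u' - (P.avgH w' u - P.avgH w u) ≤
      min c.Lw c.Lu * ‖w' - w‖ * ‖u' - u‖ := by
  -- The mixed difference is an increment in w of H(·, u') - H(·, u), whose gradient is at most
  -- L_u‖u' - u‖, and also an increment in u, which gives L_w instead.
  have h1 := norm_sub_le_of_norm_gradient_le
    (fun z => (hA.hasGradientAt_avgH_left z u').sub' (hA.hasGradientAt_avgH_left z u))
    (fun z => hA.avgGradW_sub_right hc hn z u' u) w w'
  have h2 := norm_sub_le_of_norm_gradient_le
    (fun z => (hA.hasGradientAt_avgH_right w' z).sub' (hA.hasGradientAt_avgH_right w z))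
    (fun z => hA.avgGradU_sub_left hc hn w' w z) u u'
  have h1' := (le_abs_self _).trans h1
  have h2' := (le_abs_self _).trans h2
  rcases min_cases c.Lw c.Lu with h | h <;> rw [h.1] <;> nlinarith

theorem Assumptions.avgH_strongConcaveOn (hA : Assumptions c P) (hn : 0 < n) (w : Euc p) :
    StrongConcaveOn Set.univ c.μH (P.avgH w) := by
  refine ⟨convex_univ, fun x _ y _ a b ha hb hab => ?_⟩
  have hn' : (0 : ℝ) < n := Nat.cast_pos.2 hn
  have h := average_le_average fun i =>
    (hA.concave i w).2 (Set.mem_univ x) (Set.mem_univ y) ha hb hab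
  rw [Finset.sum_add_distrib, mul_add, average_const hn] at h
  refine le_trans (le_of_eq ?_) h
  simp only [Problem.avgH, smul_eq_mul, Finset.sum_add_distrib, ← Finset.mul_sum]
  ring

theorem Assumptions.strongConvexOn_dual (hA : Assumptions c P) (hn : 0 < n) (w : Euc p) :
    StrongConvexOn (effDom P.h) c.μψ fun u => realPart P.h u - P.avgH w u := by
  have h1 : StrongConvexOn Set.univ c.μH (-(P.avgH w)) := (hA.avgH_strongConcaveOn hn w).neg
  have h2 : StrongConvexOn (effDom P.h) c.μH (-(P.avgH w)) :=
    ⟨hA.convex_h.strongConvex.1, fun x _ y _ => h1.2 (Set.mem_univ x) (Set.mem_univ y)⟩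
  have := StrongConvexOn.add hA.convex_h.strongConvex h2
  exact this

theorem Assumptions.continuous_avgH (hA : Assumptions c P) (w : Euc p) :
    Continuous (P.avgH w) :=
  continuous_iff_continuousAt.2 fun u => (hA.hasGradientAt_avgH_right w u).continuousAt

/-- The bounded domain supplies compactness: off a ball of radius 2M around a point of the domain,
`h` equals ⊤. -/
theorem Assumptions.exists_dual_minimizer (hA : Assumptions c P) (w : Euc p) :
    ∃ u ∈ effDom P.h, ∀ z ∈ effDom P.h,
      realPart P.h u - P.avgH w u ≤ realPart P.h z - P.avgH w z := by
  obtain ⟨M, hM⟩ := hA.dom_h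
  obtain ⟨x₀, hx₀⟩ := hA.convex_h.nonempty_dom
  obtain ⟨u, hu⟩ := exists_forall_le_of_lowerSemicontinuous
    (lowerSemicontinuous_add_coe hA.convex_h.closed (hA.continuous_avgH w).neg) x₀ (M + M)
    (fun y hy => by
      have : y ∉ effDom P.h := fun hyd => by
        have := norm_sub_le y x₀
        linarith [hM y hyd, hM x₀ hx₀]
      rw [eq_top_of_notMem_effDom this, EReal.top_add_coe]
      exact le_top)
  have hud : u ∈ effDom P.h := by
    by_contra hud
    have := hu x₀
    rw [eq_top_of_notMem_effDom hud, EReal.top_add_coe, ← hA.convex_h.coe_realPart hx₀,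
      ← EReal.coe_add] at this
    exact absurd this (not_le.2 (EReal.coe_lt_top _))
  refine ⟨u, hud, fun z hz => ?_⟩
  have := hu z
  rw [← hA.convex_h.coe_realPart hz, ← hA.convex_h.coe_realPart hud] at this
  have h2 : realPart P.h u + -P.avgH w u ≤ realPart P.h z + -P.avgH w z := by exact_mod_cast this
  linarith

theorem Assumptions.argmaxU_spec (hA : Assumptions c P) (w : Euc p) :
    P.argmaxU w ∈ effDom P.h ∧ ∀ z ∈ effDom P.h,
      realPart P.h (P.argmaxU w) - P.avgH w (P.argmaxU w) ≤ realPart P.h z - P.avgH w z := by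
  exact Classical.epsilon_spec (p := fun u => u ∈ effDom P.h ∧
    ∀ z ∈ effDom P.h, realPart P.h u - P.avgH w u ≤ realPart P.h z - P.avgH w z)
    (hA.exists_dual_minimizer w)

theorem Assumptions.phi_eq (hA : Assumptions c P) (w : Euc p) :
    P.Phi w = ((P.avgH w (P.argmaxU w) - realPart P.h (P.argmaxU w) : ℝ) : EReal) := by
  obtain ⟨h1, h2⟩ := hA.argmaxU_spec w
  refine le_antisymm (iSup_le fun u => ?_) ?_
  · by_cases hu : u ∈ effDom P.h
    · rw [← hA.convex_h.coe_realPart hu, ← EReal.coe_sub, EReal.coe_le_coe_iff]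
      linarith [h2 u hu]
    · rw [eq_top_of_notMem_effDom hu, sub_eq_add_neg, EReal.neg_top, EReal.add_bot]
      exact bot_le
  · rw [EReal.coe_sub, hA.convex_h.coe_realPart h1]
    exact le_iSup (fun u => ((P.avgH w u : ℝ) : EReal) - P.h u) (P.argmaxU w)

theorem Assumptions.realPart_phi (hA : Assumptions c P) (w : Euc p) :
    realPart P.Phi w = P.avgH w (P.argmaxU w) - realPart P.h (P.argmaxU w) := by
  rw [realPart, hA.phi_eq, EReal.toReal_coe]

theorem Assumptions.coe_realPart_phi (hA : Assumptions c P) (w : Euc p) :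
    ((realPart P.Phi w : ℝ) : EReal) = P.Phi w := by
  rw [hA.realPart_phi, hA.phi_eq]

theorem Assumptions.dual_growth (hA : Assumptions c P) (hn : 0 < n) (w : Euc p) {u : Euc q}
    (hu : u ∈ effDom P.h) :
    P.avgH w u - realPart P.h u + c.μψ / 2 * ‖u - P.argmaxU w‖ ^ 2 ≤ realPart P.Phi w := by
  have := StrongConvexOn.add_sq_le_of_forall_le (hA.strongConvexOn_dual hn w)
    (hA.argmaxU_spec w).1 (hA.argmaxU_spec w).2 hu
  rw [hA.realPart_phi]
  linarith

/-- Adding the growth inequalities at the two maximizers cancels `h` and leaves μ times their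
squared distance below a mixed difference of H. Both members of the minimum are needed: L_u makes u*
κ-Lipschitz, L_w produces the constant (1 + κ)L_w of Φ₀. -/
theorem Assumptions.argmaxU_sub_le (hA : Assumptions c P) (hc : c.Valid) (hn : 0 < n)
    (w w' : Euc p) :
    c.μψ * ‖P.argmaxU w' - P.argmaxU w‖ ≤ min c.Lw c.Lu * ‖w' - w‖ := by
  have h1 := hA.dual_growth hn w (hA.argmaxU_spec w').1
  have h2 := hA.dual_growth hn w' (hA.argmaxU_spec w).1
  have h3 := hA.mixed_difference_le hc hn w w' (P.argmaxU w) (P.argmaxU w')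
  rw [hA.realPart_phi] at h1 h2
  rw [norm_sub_rev (P.argmaxU w)] at h2
  set d := ‖P.argmaxU w' - P.argmaxU w‖
  have h4 : c.μψ * d * d ≤ min c.Lw c.Lu * ‖w' - w‖ * d := by nlinarith
  rcases (show 0 ≤ d from norm_nonneg _).eq_or_lt with hd | hd
  · rw [← hd, mul_zero]
    exact mul_nonneg (le_min hc.Lw_pos.le hc.Lu_pos.le) (norm_nonneg _)
  · exact le_of_mul_le_mul_right h4 hd

theorem Consts.Valid.μψ_pos (hc : c.Valid) : 0 < c.μψ := hc.μ_pos

theorem Consts.Valid.κ_pos (hc : c.Valid) : 0 < c.κ := div_pos hc.Lu_pos hc.μψ_pos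

theorem Consts.Valid.κ_mul (hc : c.Valid) : c.κ * c.μψ = c.Lu :=
  div_mul_cancel₀ _ hc.μψ_pos.ne'

theorem Assumptions.argmaxU_lipschitz (hA : Assumptions c P) (hc : c.Valid) (hn : 0 < n)
    (w w' : Euc p) : ‖P.argmaxU w' - P.argmaxU w‖ ≤ c.κ * ‖w' - w‖ := by
  have h1 := (hA.argmaxU_sub_le hc hn w w').trans
    (mul_le_mul_of_nonneg_right (min_le_right _ _) (norm_nonneg _))
  rw [← hc.κ_mul] at h1
  refine le_of_mul_le_mul_left ?_ hc.μψ_pos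
  linarith

/-- Expand H(·, u*(w')) at w and use that Φ₀(w) dominates H(w, u*(w')) - h(u*(w')). Replacing u*(w')
by u*(w) in the slope costs κL_w‖w' - w‖²; with L_w/2 from the expansion this stays below `LPhi`. -/
theorem Assumptions.phi_le (hA : Assumptions c P) (hc : c.Valid) (hn : 0 < n) (w w' : Euc p) :
    realPart P.Phi w' ≤ realPart P.Phi w + ⟪P.avgGradW w (P.argmaxU w), w' - w⟫_ℝ +
      c.LPhi * ‖w' - w‖ ^ 2 := by
  have h1 := le_add_inner_add_sq_of_gradient_lipschitz
    (fun z => hA.hasGradientAt_avgH_left z (P.argmaxU w'))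
    (fun x y => hA.avgGradW_sub_left hc hn x y _) w w'
  have h2 := hA.dual_growth hn w (hA.argmaxU_spec w').1
  have h3 : ⟪P.avgGradW w (P.argmaxU w'), w' - w⟫_ℝ - ⟪P.avgGradW w (P.argmaxU w), w' - w⟫_ℝ ≤
      c.κ * c.Lw * ‖w' - w‖ ^ 2 := by
    rw [← inner_sub_left]
    have h4 := hA.avgGradW_sub_right hc hn w (P.argmaxU w') (P.argmaxU w)
    have h5 := (hA.argmaxU_sub_le hc hn w w').trans
      (mul_le_mul_of_nonneg_right (min_le_left _ _) (norm_nonneg _))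
    have h6 : c.Lu * ‖P.argmaxU w' - P.argmaxU w‖ ≤ c.κ * (c.Lw * ‖w' - w‖) := by
      rw [← hc.κ_mul, mul_assoc]
      exact mul_le_mul_of_nonneg_left h5 hc.κ_pos.le
    calc _ ≤ _ := real_inner_le_norm _ _
      _ ≤ c.κ * (c.Lw * ‖w' - w‖) * ‖w' - w‖ := by
        gcongr
        exact h4.trans h6
      _ = _ := by ring
  have h7 : 0 ≤ c.μψ / 2 * ‖P.argmaxU w' - P.argmaxU w‖ ^ 2 := by
    have := hc.μψ_pos
    positivity
  have h8 : 0 ≤ c.Lw / 2 * ‖w' - w‖ ^ 2 := by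
    have := hc.Lw_pos
    positivity
  rw [hA.realPart_phi w', Consts.LPhi]
  linarith

/-- Keeping u*(w) as a competitor at w' gives the lower bound, and the slope needs no correction. -/
theorem Assumptions.le_phi (hA : Assumptions c P) (hc : c.Valid) (hn : 0 < n) (w w' : Euc p) :
    realPart P.Phi w + ⟪P.avgGradW w (P.argmaxU w), w' - w⟫_ℝ - c.LPhi * ‖w' - w‖ ^ 2 ≤
      realPart P.Phi w' := by
  have h1 := add_inner_sub_sq_le_of_gradient_lipschitz
    (fun z => hA.hasGradientAt_avgH_left z (P.argmaxU w))
    (fun x y => hA.avgGradW_sub_left hc hn x y _) w w'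
  have h2 := hA.dual_growth hn w' (hA.argmaxU_spec w).1
  have h7 : 0 ≤ c.μψ / 2 * ‖P.argmaxU w - P.argmaxU w'‖ ^ 2 := by
    have := hc.μψ_pos
    positivity
  have h8 : 0 ≤ (1 / 2 + c.κ) * c.Lw * ‖w' - w‖ ^ 2 := by
    have := hc.Lw_pos
    have := hc.κ_pos
    positivity
  rw [hA.realPart_phi w, Consts.LPhi]
  linarith

theorem Assumptions.hasGradientAt_phi (hA : Assumptions c P) (hc : c.Valid) (hn : 0 < n)
    (w : Euc p) : HasGradientAt (realPart P.Phi) (P.avgGradW w (P.argmaxU w)) w := by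
  rw [hasGradientAt_iff_isLittleO]
  refine Asymptotics.IsBigO.trans_isLittleO (g := fun x => ‖x - w‖ ^ 2) ?_ ?_
  · refine Asymptotics.IsBigO.of_bound c.LPhi (Filter.Eventually.of_forall fun x => ?_)
    rw [Real.norm_eq_abs, Real.norm_of_nonneg (by positivity), abs_le]
    constructor
    · linarith [hA.le_phi hc hn w x]
    · linarith [hA.phi_le hc hn w x]
  · have h := Asymptotics.isLittleO_pow_sub_sub w (m := 2) one_lt_two
    exact h

theorem Assumptions.gradPhi_eq (hA : Assumptions c P) (hc : c.Valid) (hn : 0 < n)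
    (w : Euc p) : P.gradPhi w = P.avgGradW w (P.argmaxU w) :=
  (hA.hasGradientAt_phi hc hn w).gradient

theorem Assumptions.effDom_phi (hA : Assumptions c P) (w : Euc p) : w ∈ effDom P.Phi := by
  rw [effDom, Set.mem_ofPred_eq, hA.phi_eq]
  exact EReal.coe_lt_top _

theorem Assumptions.concaveOn_H (hA : Assumptions c P) (hc : c.Valid) (i : Fin n) (w : Euc p) :
    ConcaveOn ℝ Set.univ (P.H i w) :=
  strongConcaveOn_zero.1 (StrongConcaveOn.mono hc.μH_nonneg (hA.concave i w))

/-- First-order optimality: ∇_u H(w, u*(w)) is a subgradient of `h` at u*(w), obtained from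
difference quotients along segments. -/
theorem Assumptions.inner_le_dual (hA : Assumptions c P) (hc : c.Valid) (hn : 0 < n) (w : Euc p)
    {z : Euc q} (hz : z ∈ effDom P.h) :
    realPart P.h (P.argmaxU w) + ⟪P.avgGradU w (P.argmaxU w), z - P.argmaxU w⟫_ℝ ≤
      realPart P.h z := by
  obtain ⟨hx, hmin⟩ := hA.argmaxU_spec w
  set x := P.argmaxU w
  refine le_of_forall_le_add_mul (c := c.Lu / 2 * ‖z - x‖ ^ 2) fun t ht ht1 => ?_
  have hconv : ConvexOn ℝ (effDom P.h) (realPart P.h) :=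
    strongConvexOn_zero.1 (StrongConvexOn.mono hc.μh_nonneg hA.convex_h.strongConvex)
  have h1 := hconv.2 hz hx ht.le (sub_nonneg.2 ht1) (by ring)
  have h2 := hmin _ (hconv.1 hz hx ht.le (sub_nonneg.2 ht1) (by ring))
  have h3 := add_inner_sub_sq_le_of_gradient_lipschitz (fun y => hA.hasGradientAt_avgH_right w y)
    (fun y y' => hA.avgGradU_sub_right hc hn w y y') x (t • z + (1 - t) • x)
  have h4 : t • z + (1 - t) • x - x = t • (z - x) := by module
  rw [h4, inner_smul_right, norm_smul, Real.norm_eq_abs, abs_of_pos ht] at h3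
  simp only [smul_eq_mul] at h1
  refine le_of_mul_le_mul_left (a := t) ?_ ht
  nlinarith

/-- By the optimality condition u*(w) is a fixed point of the proximal ascent step. This removes the
Λ̂₀ term from the growth condition at u*(w). -/
theorem Assumptions.dualGradMap_argmaxU (hA : Assumptions c P) (hc : c.Valid) (hn : 0 < n)
    {η : ℝ} (hη : 0 < η) (w : Euc p) : P.dualGradMap η w (P.argmaxU w) = 0 := by
  set x := P.argmaxU w with hx
  have hxd : x ∈ effDom P.h := (hA.argmaxU_spec w).1
  have hprox : IsProx P.h η (x + η • P.avgGradU w x) x := by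
    intro z
    by_cases hz : z ∈ effDom P.h
    · rw [← hA.convex_h.coe_realPart hxd, ← hA.convex_h.coe_realPart hz, ← EReal.coe_add,
        ← EReal.coe_add, EReal.coe_le_coe_iff]
      have h1 := hA.inner_le_dual hc hn w hz
      rw [← hx] at h1
      have e1 : x - (x + η • P.avgGradU w x) = - (η • P.avgGradU w x) := by abel
      have e2 : z - (x + η • P.avgGradU w x) = (z - x) - η • P.avgGradU w x := by abel
      rw [e1, e2, norm_neg, norm_sub_sq_real (z - x), inner_smul_right, real_inner_comm]
      have h2 : (‖z - x‖ ^ 2 - 2 * (η * ⟪P.avgGradU w x, z - x⟫_ℝ) + ‖η • P.avgGradU w x‖ ^ 2) /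
          (2 * η) = ‖z - x‖ ^ 2 / (2 * η) - ⟪P.avgGradU w x, z - x⟫_ℝ +
            ‖η • P.avgGradU w x‖ ^ 2 / (2 * η) := by
        field_simp
      rw [h2]
      have h3 : 0 ≤ ‖z - x‖ ^ 2 / (2 * η) := by positivity
      linarith
    · rw [eq_top_of_notMem_effDom hz, EReal.top_add_coe]
      exact le_top
  have := (hA.convex_h.isProx_prox hc.μh_nonneg hη _).eq hA.convex_h hc.μh_nonneg hη hprox
  rw [Problem.dualGradMap, this, sub_self, smul_zero]

end Gradients

/-! ### Shuffled epochs and the deviation of their inner iterates. -/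

section Shuffling

theorem sum_range_cast_le (n : ℕ) : ∑ i ∈ Finset.range n, (i : ℝ) ≤ (n : ℝ) ^ 2 / 2 := by
  induction n with
  | zero => simp
  | succ k ih =>
    rw [Finset.sum_range_succ]
    push_cast
    nlinarith

theorem sum_range_cast_sq_le (n : ℕ) : ∑ i ∈ Finset.range n, (i : ℝ) ^ 2 ≤ (n : ℝ) ^ 3 / 3 := by
  induction n with
  | zero => simp
  | succ k ih =>
    rw [Finset.sum_range_succ]
    push_cast
    nlinarith [(Nat.cast_nonneg k : (0 : ℝ) ≤ k)]

variable {E : Type*} [NormedAddCommGroup E]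

theorem norm_add_add_sq_le (a b c : E) :
    ‖a + b + c‖ ^ 2 ≤ 3 * (‖a‖ ^ 2 + ‖b‖ ^ 2 + ‖c‖ ^ 2) := by
  have h : ‖a + b + c‖ ≤ ‖a‖ + ‖b‖ + ‖c‖ := norm_add₃_le
  have := pow_le_pow_left₀ (norm_nonneg _) h 2
  nlinarith [sq_nonneg (‖a‖ - ‖b‖), sq_nonneg (‖a‖ - ‖c‖), sq_nonneg (‖b‖ - ‖c‖)]

theorem norm_sub_sq_le_two_mul (x y z : E) :
    ‖x - z‖ ^ 2 ≤ 2 * ‖x - y‖ ^ 2 + 2 * ‖y - z‖ ^ 2 := by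
  have := pow_le_pow_left₀ (norm_nonneg _) (norm_sub_le_norm_sub_add_norm_sub x y z) 2
  nlinarith [sq_nonneg (‖x - y‖ - ‖y - z‖)]

variable [InnerProductSpace ℝ E]

theorem eq_add_smul_sum_range {x v : ℕ → E} {a : ℝ} {n : ℕ}
    (h : ∀ k < n, x (k + 1) = x k + a • v k) {i : ℕ} (hi : i ≤ n) :
    x i = x 0 + a • ∑ j ∈ Finset.range i, v j := by
  induction i with
  | zero => simp
  | succ k ih =>
    rw [h k hi, ih (Nat.le_of_succ_le hi), Finset.sum_range_succ, smul_add, add_assoc]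

/-- Mean square deviation of the inner iterates of an epoch from its starting point. -/
theorem average_deviation_sq_le {n : ℕ} (hn : 0 < n) {x A B : ℕ → E} {C : E} {η : ℝ}
    (h : ∀ k < n, x (k + 1) = x k + (η / n) • (A k + B k + C)) :
    (1 / (n : ℝ)) * ∑ k ∈ Finset.range n, ‖x k - x 0‖ ^ 2 ≤
      3 * η ^ 2 * (1 / 2 * ((1 / (n : ℝ)) * ∑ k ∈ Finset.range n, ‖A k‖ ^ 2) +
        1 / 2 * ((1 / (n : ℝ)) * ∑ k ∈ Finset.range n, ‖B k‖ ^ 2) + 1 / 3 * ‖C‖ ^ 2) := by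
  have hn' : (0 : ℝ) < n := Nat.cast_pos.2 hn
  set SA := ∑ k ∈ Finset.range n, ‖A k‖ ^ 2 with hSA
  set SB := ∑ k ∈ Finset.range n, ‖B k‖ ^ 2 with hSB
  have hSA0 : 0 ≤ SA := Finset.sum_nonneg fun _ _ => by positivity
  have hSB0 : 0 ≤ SB := Finset.sum_nonneg fun _ _ => by positivity
  -- Cauchy–Schwarz on the first i increments. Partial sums of squares are replaced by full ones,
  -- since nothing is known about the order. The varying parts then grow like i and the constant
  -- part like i², whence the weights 1/2 and 1/3.
  have h1 : ∀ i ∈ Finset.range n, ‖x i - x 0‖ ^ 2 ≤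
      3 * (η / n) ^ 2 * (SA + SB) * i + 3 * (η / n) ^ 2 * ‖C‖ ^ 2 * (i : ℝ) ^ 2 := by
    intro i hi
    rw [Finset.mem_range] at hi
    rw [eq_add_smul_sum_range h hi.le, add_sub_cancel_left, norm_smul, mul_pow, Real.norm_eq_abs,
      sq_abs, Finset.sum_add_distrib, Finset.sum_add_distrib, Finset.sum_const, Finset.card_range,
      ← Nat.cast_smul_eq_nsmul ℝ i C]
    have hsub : Finset.range i ⊆ Finset.range n := Finset.range_subset_range.2 hi.le
    have hA : ‖∑ j ∈ Finset.range i, A j‖ ^ 2 ≤ i * SA := by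
      have := norm_sum_sq_le_card_mul (Finset.range i) A
      rw [Finset.card_range] at this
      refine this.trans (mul_le_mul_of_nonneg_left ?_ (Nat.cast_nonneg i))
      exact Finset.sum_le_sum_of_subset_of_nonneg hsub fun _ _ _ => by positivity
    have hB : ‖∑ j ∈ Finset.range i, B j‖ ^ 2 ≤ i * SB := by
      have := norm_sum_sq_le_card_mul (Finset.range i) B
      rw [Finset.card_range] at this
      refine this.trans (mul_le_mul_of_nonneg_left ?_ (Nat.cast_nonneg i))
      exact Finset.sum_le_sum_of_subset_of_nonneg hsub fun _ _ _ => by positivity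
    have hC : ‖(i : ℝ) • C‖ ^ 2 = (i : ℝ) ^ 2 * ‖C‖ ^ 2 := by
      rw [norm_smul, mul_pow, Real.norm_eq_abs, sq_abs]
    calc _ ≤ (η / n) ^ 2 * (3 * (i * SA + i * SB + (i : ℝ) ^ 2 * ‖C‖ ^ 2)) := by
          refine mul_le_mul_of_nonneg_left ((norm_add_add_sq_le _ _ _).trans ?_) (by positivity)
          rw [hC]
          linarith
      _ = _ := by ring
  have h2 := Finset.sum_le_sum h1
  rw [Finset.sum_add_distrib, ← Finset.mul_sum, ← Finset.mul_sum] at h2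
  have h3 : ∑ k ∈ Finset.range n, ‖x k - x 0‖ ^ 2 ≤
      3 * (η / n) ^ 2 * (SA + SB) * ((n : ℝ) ^ 2 / 2) +
        3 * (η / n) ^ 2 * ‖C‖ ^ 2 * ((n : ℝ) ^ 3 / 3) := by
    refine h2.trans ?_
    gcongr
    · exact sum_range_cast_le n
    · exact sum_range_cast_sq_le n
  calc _ ≤ (1 / (n : ℝ)) * (3 * (η / n) ^ 2 * (SA + SB) * ((n : ℝ) ^ 2 / 2) +
        3 * (η / n) ^ 2 * ‖C‖ ^ 2 * ((n : ℝ) ^ 3 / 3)) := by gcongr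
    _ = _ := by field_simp

variable {n : ℕ}

/-- The end point of an epoch that runs through the components in the order `π`. -/
noncomputable def shuffleEpoch (G : Fin n → E → E) (a : ℝ) (π : Equiv.Perm (Fin n)) (x : E) : E :=
  (order π).foldl (fun y i => y + a • G i y) x

theorem exists_shuffle_path (G : Fin n → E → E) (a : ℝ) (π : Equiv.Perm (Fin n)) (u : E) :
    ∃ x : ℕ → E, x 0 = u ∧ (∀ k : Fin n, x (k + 1) = x k + a • G (π k) (x k)) ∧
      x n = shuffleEpoch G a π u := by
  refine ⟨fun k => ((order π).take k).foldl (fun y i => y + a • G i y) u, by simp, fun k => ?_, ?_⟩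
  · have : (order π)[(k : ℕ)]? = some (π k) := by simp [order]
    simp only [List.take_add_one, this, List.foldl_append, Option.toList_some, List.foldl_cons,
      List.foldl_nil]
  · have : (order π).take n = order π := List.take_of_length_le (by simp [order])
    simp only [this, shuffleEpoch]

/-- An epoch as a single step along an average direction, together with a bound for the mean square
deviation `S` of its inner iterates `x`. -/
theorem exists_shuffle_path_deviation (hn : 0 < n) (G : Fin n → E → E) (η : ℝ)
    (π : Equiv.Perm (Fin n)) (u : E) : ∃ x : Fin n → E,
      shuffleEpoch G (η / n) π u = u + η • ((1 / (n : ℝ)) • ∑ k, G (π k) (x k)) ∧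
      ∀ (D : Fin n → E) (C : E), (1 / (n : ℝ)) * ∑ k, ‖x k - u‖ ^ 2 ≤
        3 * η ^ 2 * (1 / 2 * ((1 / (n : ℝ)) * ∑ k, ‖G (π k) (x k) - D (π k)‖ ^ 2) +
          1 / 2 * ((1 / (n : ℝ)) * ∑ k, ‖D k - C‖ ^ 2) + 1 / 3 * ‖C‖ ^ 2) := by
  obtain ⟨x, hx0, hx, hxn⟩ := exists_shuffle_path G (η / n) π u
  refine ⟨fun k => x k, ?_, fun D C => ?_⟩
  · let v : ℕ → E := fun j => if h : j < n then G (π ⟨j, h⟩) (x j) else 0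
    have hv : ∀ k < n, x (k + 1) = x k + (η / n) • v k := fun k hk => by
      simp only [v, dif_pos hk]
      exact hx ⟨k, hk⟩
    rw [← hxn, eq_add_smul_sum_range hv le_rfl, hx0, smul_smul, mul_one_div,
      ← Fin.sum_univ_eq_sum_range]
    simp [v]
  · let A : ℕ → E := fun j => if h : j < n then G (π ⟨j, h⟩) (x j) - D (π ⟨j, h⟩) else 0
    let B : ℕ → E := fun j => if h : j < n then D (π ⟨j, h⟩) - C else 0
    have hv : ∀ k < n, x (k + 1) = x k + (η / n) • (A k + B k + C) := fun k hk => by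
      simp only [A, B, dif_pos hk, sub_add_sub_cancel, sub_add_cancel]
      exact hx ⟨k, hk⟩
    have h := average_deviation_sq_le hn hv
    rw [← Fin.sum_univ_eq_sum_range, ← Fin.sum_univ_eq_sum_range (fun k => ‖A k‖ ^ 2),
      ← Fin.sum_univ_eq_sum_range (fun k => ‖B k‖ ^ 2), hx0] at h
    simp only [A, B, Fin.is_lt, dif_pos, Fin.eta] at h
    -- The middle part no longer sees the inner iterates, so the permutation drops out and the
    -- variance assumption becomes applicable.
    rwa [Equiv.sum_comp π (fun k => ‖D k - C‖ ^ 2)] at h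

end Shuffling

/-! ### The programs evaluate to shuffled epochs followed by proximal steps. -/

section Loops

variable {n p q : ℕ}

theorem eval_ascentLoop (P : Problem n p q) (a : ℝ) (w : Euc p) (l : List (Fin n)) (u : Euc q) :
    (ascentLoop a w l u).eval P = l.foldl (fun y i => y + a • P.gradU i w y) u := by
  induction l generalizing u with
  | nil => rfl
  | cons i is ih => exact ih _

/-- The minus sign is moved into the gradient so that both loops are instances of `shuffleEpoch`. -/
theorem eval_descentLoop (P : Problem n p q) (a : ℝ) (u : Euc q) (l : List (Fin n)) (w : Euc p) :
    (descentLoop a u l w).eval P = l.foldl (fun y i => y + a • -P.gradW i y u) w := by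
  induction l generalizing w with
  | nil => rfl
  | cons i is ih =>
    refine (ih _).trans ?_
    rw [List.foldl_cons, smul_neg, ← sub_eq_add_neg]

theorem eval_bind {α β : Type} (P : Problem n p q) (x : Prog n p q α) (g : α → Prog n p q β) :
    (x.bind g).eval P = (g (x.eval P)).eval P := by
  induction x with
  | ret a => rfl
  | gradW i w u k ih => exact ih _
  | gradU i w u k ih => exact ih _
  | proxF η w k ih => exact ih _
  | proxH η w k ih => exact ih _

/-- The dual iterate after one epoch. -/
noncomputable def nextU (P : Problem n p q) (ηh : ℝ) (π : Equiv.Perm (Fin n)) (w : Euc p)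
    (u : Euc q) : Euc q :=
  prox P.h ηh (shuffleEpoch (fun i y => P.gradU i w y) (ηh / n) π u)

/-- The primal iterate after one epoch. -/
noncomputable def nextW (P : Problem n p q) (η : ℝ) (π : Equiv.Perm (Fin n)) (w : Euc p)
    (u : Euc q) : Euc p :=
  prox P.f η (shuffleEpoch (fun i y => -P.gradW i y u) (η / n) π w)

theorem eval_epoch (P : Problem n p q) (η ηh : ℝ) (π π' : Equiv.Perm (Fin n))
    (z : Euc p × Euc q) : (epoch η ηh π π' z).eval P =
      (nextW P η π' z.1 (nextU P ηh π z.1 z.2), nextU P ηh π z.1 z.2) := by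
  simp only [epoch, eval_bind, Prog.eval, eval_ascentLoop, eval_descentLoop, nextW, nextU,
    shuffleEpoch]

end Loops

/-! ### Contraction of the ascent epoch towards the dual maximizer. -/

section DualEpoch

variable {n p q : ℕ} {c : Consts} {P : Problem n p q}

/-- At u*(w) the growth condition reads ‖∇_u H‖² ≤ Λ̂₁, so variance and mean gradient are bounded by
constants; this is the origin of C_u. -/
theorem Assumptions.dual_variance_le (hA : Assumptions c P) (hc : c.Valid) (hn : 0 < n) {η : ℝ}
    (hη : 0 < η) (hD : DualGradMapBound c P η) {w : Euc p} (hw : w ∈ effDom P.f) :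
    c.Lu ^ 2 * (3 * η ^ 2 * (1 / 2 * ((1 / (n : ℝ)) *
      ∑ k, ‖P.gradU k w (P.argmaxU w) - P.avgGradU w (P.argmaxU w)‖ ^ 2) +
        1 / 3 * ‖P.avgGradU w (P.argmaxU w)‖ ^ 2)) ≤ η ^ 2 * c.Cu := by
  have h1 := hD w hw _ (hA.argmaxU_spec w).1
  rw [hA.dualGradMap_argmaxU hc hn hη, norm_zero] at h1
  have h2 := hA.variance_u w (P.argmaxU w)
  have h3 := mul_le_mul_of_nonneg_left h1 hc.Θu_nonneg
  have h4 : 0 ≤ c.Lu ^ 2 * η ^ 2 := by positivity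
  rw [Consts.Cu]
  have h5 : 3 * (1 / 2 * ((1 / (n : ℝ)) *
      ∑ k, ‖P.gradU k w (P.argmaxU w) - P.avgGradU w (P.argmaxU w)‖ ^ 2) +
        1 / 3 * ‖P.avgGradU w (P.argmaxU w)‖ ^ 2) ≤
      (c.dΛ1 * (3 * c.Θu + 2) + 3 * c.σu ^ 2) / 2 := by linarith
  calc _ = c.Lu ^ 2 * η ^ 2 * (3 * (1 / 2 * ((1 / (n : ℝ)) *
      ∑ k, ‖P.gradU k w (P.argmaxU w) - P.avgGradU w (P.argmaxU w)‖ ^ 2) +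
        1 / 3 * ‖P.avgGradU w (P.argmaxU w)‖ ^ 2)) := by ring
    _ ≤ _ := mul_le_mul_of_nonneg_left h5 h4
    _ = _ := by ring

theorem Assumptions.hasGradientAt_neg_H_right (hA : Assumptions c P) (i : Fin n) (w : Euc p)
    (u : Euc q) : HasGradientAt (fun u' => -P.H i w u') (-P.gradU i w u) u := by
  rw [hasGradientAt_iff_hasFDerivAt, map_neg]
  exact (hA.hasGradientAt_H_right i w u).hasFDerivAt.neg

/-- Cocoercivity of the convex function -H_i(w,·), in terms of the gap between its tangent at z and
its value at y. -/
theorem Assumptions.norm_gradU_sub_sq_le (hA : Assumptions c P) (hc : c.Valid) (i : Fin n)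
    (w : Euc p) (y z : Euc q) : ‖P.gradU i w z - P.gradU i w y‖ ^ 2 ≤
      2 * c.Lu * (P.H i w z + ⟪P.gradU i w z, y - z⟫_ℝ - P.H i w y) := by
  have h := norm_gradient_sub_sq_le_of_convexOn (hA.hasGradientAt_neg_H_right i w) hc.Lu_pos
    (fun y z => by rw [neg_sub_neg, norm_sub_rev]; exact hA.gradU_sub_right hc i w y z)
    (hA.concaveOn_H hc i w).neg z y
  rw [neg_sub_neg, inner_neg_left] at h
  linarith

theorem Assumptions.average_H (π : Equiv.Perm (Fin n)) (w : Euc p) (y : Euc q) :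
    (1 / (n : ℝ)) * ∑ k, P.H (π k) w y = P.avgH w y := by
  rw [Problem.avgH, Equiv.sum_comp π (fun k => P.H k w y)]

theorem inner_average_left {E : Type*} [NormedAddCommGroup E] [InnerProductSpace ℝ E]
    (v : Fin n → E) (z : E) :
    ⟪(1 / (n : ℝ)) • ∑ k, v k, z⟫_ℝ = (1 / (n : ℝ)) * ∑ k, ⟪v k, z⟫_ℝ := by
  rw [inner_smul_left, sum_inner, conj_trivial]

/-- The full modulus μ comes from the growth of H(w,·) - h at its maximizer; the extra μ_h in the
three-point inequality is discarded. -/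
theorem Assumptions.nextU_three_point (hA : Assumptions c P) (hc : c.Valid) {η : ℝ} (hη : 0 < η)
    (hn : 0 < n) (w : Euc p) (u g : Euc q) :
    (1 + η * c.μψ) * ‖prox P.h η (u + η • g) - P.argmaxU w‖ ^ 2 ≤ ‖u - P.argmaxU w‖ ^ 2 -
      ‖prox P.h η (u + η • g) - u‖ ^ 2 + 2 * η * (⟪g, prox P.h η (u + η • g) - P.argmaxU w⟫_ℝ -
        (P.avgH w (prox P.h η (u + η • g)) - P.avgH w (P.argmaxU w))) := by
  have hprox := hA.convex_h.isProx_prox hc.μh_nonneg hη (u - η • (-g))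
  have h1 := hprox.three_point hA.convex_h hη (hA.argmaxU_spec w).1
  have h2 := hA.dual_growth hn w (hprox.mem_effDom hA.convex_h)
  rw [smul_neg, sub_neg_eq_add] at h1 h2
  set y := prox P.h η (u + η • g)
  set x := P.argmaxU w
  rw [inner_neg_left, norm_sub_rev x y, norm_sub_rev x u] at h1
  rw [hA.realPart_phi] at h2
  have h3 : 0 ≤ c.μh * ‖y - x‖ ^ 2 := mul_nonneg hc.μh_nonneg (by positivity)
  have h4 : c.μψ / 2 * ‖y - x‖ ^ 2 + 1 / η / 2 * ‖y - x‖ ^ 2 + ‖y - u‖ ^ 2 / (2 * η) ≤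
      ‖u - x‖ ^ 2 / (2 * η) + (⟪g, y - x⟫_ℝ - (P.avgH w y - P.avgH w x)) := by linarith
  have h5 := mul_le_mul_of_nonneg_left h4 (show 0 ≤ 2 * η by positivity)
  have e1 : 2 * η * (c.μψ / 2 * ‖y - x‖ ^ 2 + 1 / η / 2 * ‖y - x‖ ^ 2 + ‖y - u‖ ^ 2 / (2 * η)) =
      (1 + η * c.μψ) * ‖y - x‖ ^ 2 + ‖y - u‖ ^ 2 := by
    field_simp
    ring
  have e2 : 2 * η * (‖u - x‖ ^ 2 / (2 * η) + (⟪g, y - x⟫_ℝ - (P.avgH w y - P.avgH w x))) =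
      ‖u - x‖ ^ 2 + 2 * η * (⟪g, y - x⟫_ℝ - (P.avgH w y - P.avgH w x)) := by
    field_simp
  rw [e1, e2] at h5
  linarith

/-- The error term is the mean tangent gap at the new point minus the mean tangent gap B at u*(w).
By cocoercivity B controls the gradient deviations that enter S, so the negative term -B absorbs the
part of S that depends on the iterates. The remaining noise carries the factor 4/(3L_u), which is at
most 4/μ exactly when κ ≥ 1/3. -/
theorem Assumptions.nextU_dist_le_of_le_κ (hA : Assumptions c P) (hc : c.Valid) (hn : 0 < n)
    {η : ℝ} (hη : 0 < η) (hηL : η * c.Lu ≤ 1 / 4) (hκ : 1 / 3 ≤ c.κ)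
    (hD : DualGradMapBound c P η) {w : Euc p} (hw : w ∈ effDom P.f) (u : Euc q)
    (π : Equiv.Perm (Fin n)) :
    (1 + η * c.μψ / 2) * ‖nextU P η π w u - P.argmaxU w‖ ^ 2 ≤
      ‖u - P.argmaxU w‖ ^ 2 + 4 / c.μψ * c.Cu * η ^ 3 := by
  obtain ⟨z, hz, hS⟩ := exists_shuffle_path_deviation hn (fun i y => P.gradU i w y) η π u
  have hS := hS (fun i => P.gradU i w (P.argmaxU w)) (P.avgGradU w (P.argmaxU w))
  have hV := hA.dual_variance_le hc hn hη hD hw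
  have hE := hA.nextU_three_point hc hη hn w u ((1 / (n : ℝ)) • ∑ k, P.gradU (π k) w (z k))
  rw [nextU, hz]
  set g := (1 / (n : ℝ)) • ∑ k, P.gradU (π k) w (z k) with hg
  set y := prox P.h η (u + η • g)
  set x := P.argmaxU w
  set S := (1 / (n : ℝ)) * ∑ k, ‖z k - u‖ ^ 2 with hSdef
  set V := (1 / (n : ℝ)) * ∑ k, ‖P.gradU k w x - P.avgGradU w x‖ ^ 2
  have hL := hc.Lu_pos
  have hμ := hc.μψ_pos
  let b : Euc q → Fin n → ℝ := fun y k =>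
    P.H (π k) w (z k) + ⟪P.gradU (π k) w (z k), y - z k⟫_ℝ - P.H (π k) w y
  set B := (1 / (n : ℝ)) * ∑ k, b x k with hB
  have hBA : (1 / (n : ℝ)) * ∑ k, ‖P.gradU (π k) w (z k) - P.gradU (π k) w x‖ ^ 2 ≤
      2 * c.Lu * B := by
    have := average_le_average fun k => hA.norm_gradU_sub_sq_le hc (π k) w x (z k)
    rw [← Finset.mul_sum] at this
    refine this.trans (le_of_eq ?_)
    rw [hB]
    ring
  have hB0 : 0 ≤ B := by
    have : 0 ≤ (1 / (n : ℝ)) * ∑ k, ‖P.gradU (π k) w (z k) - P.gradU (π k) w x‖ ^ 2 := by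
      positivity
    exact nonneg_of_mul_nonneg_right (this.trans hBA) (by positivity)
  have hby : (1 / (n : ℝ)) * ∑ k, b y k ≤ 2 * c.Lu * ‖y - u‖ ^ 2 + 2 / 3 * c.Lu * S := by
    have h1 : ∀ k, b y k ≤ 2 * c.Lu * ‖y - u‖ ^ 2 + 2 / 3 * c.Lu * ‖z k - u‖ ^ 2 := by
      intro k
      have h2 := add_inner_sub_sq_le_of_gradient_lipschitz (hA.hasGradientAt_H_right (π k) w)
        (hA.gradU_sub_right hc (π k) w) (z k) y
      have h3 : ‖y - z k‖ ≤ ‖y - u‖ + ‖z k - u‖ := by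
        rw [norm_sub_rev (z k) u]
        exact norm_sub_le_norm_sub_add_norm_sub y u (z k)
      -- Young weights 4 and 4/3: after multiplication by 2η the first term becomes 4ηL_u‖y - u‖²,
      -- which the condition ηL_u ≤ 1/4 lets -‖y - u‖² cancel.
      have h4 : ‖y - z k‖ ^ 2 ≤ 4 * ‖y - u‖ ^ 2 + 4 / 3 * ‖z k - u‖ ^ 2 := by
        have := pow_le_pow_left₀ (norm_nonneg _) h3 2
        nlinarith [sq_nonneg (3 * ‖y - u‖ - ‖z k - u‖)]
      have h5 := mul_le_mul_of_nonneg_left h4 (show 0 ≤ c.Lu / 2 by positivity)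
      simp only [b]
      linarith
    have h6 := average_le_average h1
    rw [Finset.sum_add_distrib, mul_add, average_const hn, ← Finset.mul_sum] at h6
    refine h6.trans (le_of_eq ?_)
    rw [hSdef]
    ring
  have hinner : ⟪g, y - x⟫_ℝ - (P.avgH w y - P.avgH w x) =
      (1 / (n : ℝ)) * ∑ k, b y k - B := by
    rw [hg, inner_average_left, hB, ← Assumptions.average_H π, ← Assumptions.average_H π, ← mul_sub,
      ← mul_sub, ← mul_sub, ← Finset.sum_sub_distrib, ← Finset.sum_sub_distrib,
      ← Finset.sum_sub_distrib]
    congr 1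
    refine Finset.sum_congr rfl fun k _ => ?_
    have : y - x = (y - z k) - (x - z k) := by abel
    simp only [b]
    rw [this, inner_sub_right]
    ring
  rw [hinner] at hE
  have hS2 : c.Lu ^ 2 * S ≤ 3 * η ^ 2 * c.Lu ^ 3 * B + η ^ 2 * c.Cu := by
    have h1 : S ≤ 3 * η ^ 2 * (1 / 2 * (2 * c.Lu * B)) +
        3 * η ^ 2 * (1 / 2 * V + 1 / 3 * ‖P.avgGradU w x‖ ^ 2) := by
      refine hS.trans ?_
      rw [← mul_add (3 * η ^ 2), ← add_assoc]
      gcongr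
    have h2 := mul_le_mul_of_nonneg_left h1 (show 0 ≤ c.Lu ^ 2 by positivity)
    linarith
  have hμL : c.μψ ≤ 3 * c.Lu := by
    have := mul_le_mul_of_nonneg_right hκ hμ.le
    rw [hc.κ_mul] at this
    linarith
  have hS3 : 4 / 3 * η * c.Lu * S ≤ η / 4 * B + 4 / c.μψ * c.Cu * η ^ 3 := by
    have hη2 : (η * c.Lu) ^ 2 ≤ 1 / 16 := by nlinarith [mul_pos hη hL]
    have hCu : 0 ≤ c.Cu := by
      have := hc.dΛ1_nonneg
      have := hc.Θu_nonneg
      rw [Consts.Cu]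
      positivity
    have h1 : 4 / 3 * η * c.Lu * S = 4 / 3 * η / c.Lu * (c.Lu ^ 2 * S) := by
      field_simp
    have h2 : 4 / 3 * η / c.Lu * (3 * η ^ 2 * c.Lu ^ 3 * B + η ^ 2 * c.Cu) =
        4 * η * (η * c.Lu) ^ 2 * B + 4 / (3 * c.Lu) * c.Cu * η ^ 3 := by
      field_simp
    have h3 : 4 * η * (η * c.Lu) ^ 2 * B ≤ 4 * η * (1 / 16) * B := by gcongr
    have h4 : 4 / (3 * c.Lu) * c.Cu * η ^ 3 ≤ 4 / c.μψ * c.Cu * η ^ 3 := by gcongr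
    have h5 : 4 / 3 * η / c.Lu * (c.Lu ^ 2 * S) ≤
        4 / 3 * η / c.Lu * (3 * η ^ 2 * c.Lu ^ 3 * B + η ^ 2 * c.Cu) := by gcongr
    linarith
  have h1 := mul_le_mul_of_nonneg_left hby (show 0 ≤ 2 * η by positivity)
  have h2 : η * c.Lu * ‖y - u‖ ^ 2 ≤ 1 / 4 * ‖y - u‖ ^ 2 := by gcongr
  have h3 : 0 ≤ η * B := by positivity
  have h4 : 0 ≤ η * c.μψ * ‖y - x‖ ^ 2 := by positivity
  linarith

/-- Scalar part of the case κ ≤ 1/3. X and Y are the squared distances to u*(w) before and after the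
epoch, D is the squared step and I the linearization error. The error inflates X by 1 + t/33 and
reduces the factor of Y to 1 + 2t/3; for t ≤ 1/2 a contraction by 1 + t/2 survives. -/
theorem contraction_of_error_le {μ L η C S I X Y D : ℝ} (hμ : 0 < μ) (hL : 0 < L) (hη : 0 < η)
    (hηL : η * L ≤ 1 / 6) (hLμ : L ≤ μ / 3) (ht2 : η * μ ≤ 1 / 2) (hCu : 0 ≤ C) (hX : 0 ≤ X)
    (hY : 0 ≤ Y) (hDpos : 0 ≤ D)
    (hS2 : L ^ 2 * S ≤ 12 / 11 * (1 / 12 * L ^ 2 * X + η ^ 2 * C))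
    (hinner : I ≤ L / 2 * D + (3 / (2 * μ) * (L ^ 2 * S) + μ / 6 * Y))
    (hE : (1 + η * μ) * Y ≤ X - D + 2 * η * I) :
    (1 + η * μ / 2) * Y ≤ X + 4 / μ * C * η ^ 3 := by
  set t := η * μ with ht
  have ht0 : 0 < t := mul_pos hη hμ
  have h1 := mul_le_mul_of_nonneg_left hinner (show 0 ≤ 2 * η by positivity)
  have h2 : η * L * D ≤ 1 / 6 * D := by
    gcongr
  have h3 : 3 * η / μ * (L ^ 2 * S) ≤ 1 / 33 * t * X +
      36 / 11 / μ * C * η ^ 3 := by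
    have h4 : L ^ 2 * X ≤ (μ / 3) ^ 2 * X := by gcongr
    have h5 : L ^ 2 * S ≤ 12 / 11 * (1 / 12 * (μ / 3) ^ 2 * X + η ^ 2 * C) := by
      linarith
    calc _ ≤ 3 * η / μ *
          (12 / 11 * (1 / 12 * (μ / 3) ^ 2 * X + η ^ 2 * C)) := by gcongr
      _ = _ := by rw [ht]; field_simp; ring
  have h6 : 2 * η * (L / 2 * D +
      (3 / (2 * μ) * (L ^ 2 * S) + μ / 6 * Y)) =
      η * L * D + 3 * η / μ * (L ^ 2 * S) + t / 3 * Y := by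
    rw [ht]
    field_simp
    ring
  have h7 : (1 + 2 / 3 * t) * Y ≤ (1 + 1 / 33 * t) * X +
      36 / 11 / μ * C * η ^ 3 := by
    rw [h6] at h1
    linarith
  have hK : 36 / 11 / μ * C * η ^ 3 ≤ 4 / μ * C * η ^ 3 := by
    gcongr
    norm_num
  have hK0 : 0 ≤ 4 / μ * C * η ^ 3 := by positivity
  have h8 : (1 + 1 / 33 * t) * ((1 + t / 2) * Y) ≤
      (1 + 1 / 33 * t) * (X + 4 / μ * C * η ^ 3) := by
    have h9 : (1 + 1 / 33 * t) * (1 + t / 2) ≤ 1 + 2 / 3 * t := by nlinarith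
    have h10 := mul_le_mul_of_nonneg_right h9 (hY)
    have h11 : 0 ≤ t * (4 / μ * C * η ^ 3) := by positivity
    linarith
  exact le_of_mul_le_mul_left h8 (by positivity)

/-- For L_u ≤ μ/3 cocoercivity is unnecessary. The epoch is an inexact gradient step at u with
squared error at most L_u² S, Young's inequality charges it to (μ/6)‖y - u*(w)‖², and the L_u²‖u -
u*(w)‖² inside S is small against the contraction. -/
theorem Assumptions.nextU_dist_le_of_κ_le (hA : Assumptions c P) (hc : c.Valid) (hn : 0 < n)
    {η : ℝ} (hη : 0 < η) (hηL : η * c.Lu ≤ c.κ / 2) (hκ : c.κ ≤ 1 / 3)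
    (hD : DualGradMapBound c P η) {w : Euc p} (hw : w ∈ effDom P.f) (u : Euc q)
    (π : Equiv.Perm (Fin n)) :
    (1 + η * c.μψ / 2) * ‖nextU P η π w u - P.argmaxU w‖ ^ 2 ≤
      ‖u - P.argmaxU w‖ ^ 2 + 4 / c.μψ * c.Cu * η ^ 3 := by
  obtain ⟨z, hz, hS⟩ := exists_shuffle_path_deviation hn (fun i y => P.gradU i w y) η π u
  have hS := hS (fun i => P.gradU i w (P.argmaxU w)) (P.avgGradU w (P.argmaxU w))
  have hV := hA.dual_variance_le hc hn hη hD hw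
  have hE := hA.nextU_three_point hc hη hn w u ((1 / (n : ℝ)) • ∑ k, P.gradU (π k) w (z k))
  rw [nextU, hz]
  set g := (1 / (n : ℝ)) • ∑ k, P.gradU (π k) w (z k) with hg
  set y := prox P.h η (u + η • g)
  set x := P.argmaxU w
  set S := (1 / (n : ℝ)) * ∑ k, ‖z k - u‖ ^ 2 with hSdef
  set V := (1 / (n : ℝ)) * ∑ k, ‖P.gradU k w x - P.avgGradU w x‖ ^ 2
  have hL := hc.Lu_pos
  have hμ := hc.μψ_pos
  have hCu : 0 ≤ c.Cu := by
    have := hc.dΛ1_nonneg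
    have := hc.Θu_nonneg
    rw [Consts.Cu]
    positivity
  have hAbd : (1 / (n : ℝ)) * ∑ k, ‖P.gradU (π k) w (z k) - P.gradU (π k) w x‖ ^ 2 ≤
      2 * c.Lu ^ 2 * S + 2 * c.Lu ^ 2 * ‖u - x‖ ^ 2 := by
    have h1 : ∀ k, ‖P.gradU (π k) w (z k) - P.gradU (π k) w x‖ ^ 2 ≤
        2 * c.Lu ^ 2 * ‖z k - u‖ ^ 2 + 2 * c.Lu ^ 2 * ‖u - x‖ ^ 2 := fun k => by
      have h2 := pow_le_pow_left₀ (norm_nonneg _) (hA.gradU_sub_right hc (π k) w (z k) x) 2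
      rw [mul_pow] at h2
      have h3 := mul_le_mul_of_nonneg_left (norm_sub_sq_le_two_mul (z k) u x)
        (show 0 ≤ c.Lu ^ 2 by positivity)
      linarith
    have h6 := average_le_average h1
    rw [Finset.sum_add_distrib, mul_add, average_const hn, ← Finset.mul_sum] at h6
    refine h6.trans (le_of_eq ?_)
    rw [hSdef]
    ring
  have hηL6 : (η * c.Lu) ^ 2 ≤ 1 / 36 := by
    have : η * c.Lu ≤ 1 / 6 := by linarith
    nlinarith [mul_pos hη hL]
  have hS0 : 0 ≤ S := by positivity
  -- S occurs on both sides with coefficient 3(ηL_u)² ≤ 1/12 on the right; moving it over gives the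
  -- factor 12/11.
  have hS2 : c.Lu ^ 2 * S ≤ 12 / 11 * (1 / 12 * c.Lu ^ 2 * ‖u - x‖ ^ 2 + η ^ 2 * c.Cu) := by
    have h1 : S ≤ 3 * η ^ 2 * (1 / 2 * (2 * c.Lu ^ 2 * S + 2 * c.Lu ^ 2 * ‖u - x‖ ^ 2)) +
        3 * η ^ 2 * (1 / 2 * V + 1 / 3 * ‖P.avgGradU w x‖ ^ 2) := by
      refine hS.trans ?_
      rw [← mul_add (3 * η ^ 2), ← add_assoc]
      gcongr
    have h2 := mul_le_mul_of_nonneg_left h1 (show 0 ≤ c.Lu ^ 2 by positivity)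
    have h3 : (η * c.Lu) ^ 2 * (c.Lu ^ 2 * S + c.Lu ^ 2 * ‖u - x‖ ^ 2) ≤
        1 / 36 * (c.Lu ^ 2 * S + c.Lu ^ 2 * ‖u - x‖ ^ 2) := by gcongr
    linarith
  have hê : ‖g - P.avgGradU w u‖ ^ 2 ≤ c.Lu ^ 2 * S := by
    have e : g - P.avgGradU w u =
        (1 / (n : ℝ)) • ∑ k, (P.gradU (π k) w (z k) - P.gradU (π k) w u) := by
      rw [Finset.sum_sub_distrib, Equiv.sum_comp π (fun k => P.gradU k w u), smul_sub,
        hA.avgGradU_eq]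
    rw [e]
    refine (norm_average_sq_le hn _).trans ?_
    have h1 := average_le_average fun k =>
      pow_le_pow_left₀ (norm_nonneg _) (hA.gradU_sub_right hc (π k) w (z k) u) 2
    simp only [mul_pow, ← Finset.mul_sum] at h1
    refine h1.trans (le_of_eq ?_)
    rw [hSdef]
    ring
  have hinner : ⟪g, y - x⟫_ℝ - (P.avgH w y - P.avgH w x) ≤
      c.Lu / 2 * ‖y - u‖ ^ 2 + (3 / (2 * c.μψ) * (c.Lu ^ 2 * S) + c.μψ / 6 * ‖y - x‖ ^ 2) := by
    have h1 := add_inner_sub_sq_le_of_gradient_lipschitz (hA.hasGradientAt_avgH_right w)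
      (hA.avgGradU_sub_right hc hn w) u y
    have h2 : P.avgH w x ≤ P.avgH w u + ⟪P.avgGradU w u, x - u⟫_ℝ := by
      have hconc : ConcaveOn ℝ Set.univ (P.avgH w) :=
        strongConcaveOn_zero.1 (StrongConcaveOn.mono hc.μH_nonneg (hA.avgH_strongConcaveOn hn w))
      have h3 := add_inner_le_of_convexOn (φ := fun u => - P.avgH w u)
        (g := fun u => - P.avgGradU w u) (fun u => by
          rw [hasGradientAt_iff_hasFDerivAt, map_neg]
          exact (hA.hasGradientAt_avgH_right w u).hasFDerivAt.neg)
        (fun y z => by rw [neg_sub_neg, norm_sub_rev]; exact hA.avgGradU_sub_right hc hn w y z)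
        hconc.neg u x
      rw [inner_neg_left] at h3
      linarith
    have h3 : ⟪g - P.avgGradU w u, y - x⟫_ℝ ≤
        3 / (2 * c.μψ) * (c.Lu ^ 2 * S) + c.μψ / 6 * ‖y - x‖ ^ 2 := by
      have h4 : 3 / (2 * c.μψ) * ‖g - P.avgGradU w u‖ ^ 2 ≤
        3 / (2 * c.μψ) * (c.Lu ^ 2 * S) := by gcongr
      have h5 : ‖g - P.avgGradU w u‖ * ‖y - x‖ ≤
          3 / (2 * c.μψ) * ‖g - P.avgGradU w u‖ ^ 2 + c.μψ / 6 * ‖y - x‖ ^ 2 := by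
        rw [← sub_nonneg]
        have : 3 / (2 * c.μψ) * ‖g - P.avgGradU w u‖ ^ 2 + c.μψ / 6 * ‖y - x‖ ^ 2 -
            ‖g - P.avgGradU w u‖ * ‖y - x‖ =
            (3 * ‖g - P.avgGradU w u‖ - c.μψ * ‖y - x‖) ^ 2 / (6 * c.μψ) := by
          field_simp
          ring
        rw [this]
        positivity
      linarith [real_inner_le_norm (g - P.avgGradU w u) (y - x)]
    have e : ⟪g, y - x⟫_ℝ = ⟪g - P.avgGradU w u, y - x⟫_ℝ + (⟪P.avgGradU w u, y - u⟫_ℝ -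
        ⟪P.avgGradU w u, x - u⟫_ℝ) := by
      rw [← inner_sub_right, sub_sub_sub_cancel_right, ← inner_add_left, sub_add_cancel]
    linarith
  have hLμ : c.Lu ≤ c.μψ / 3 := by
    have := mul_le_mul_of_nonneg_right hκ hμ.le
    rw [hc.κ_mul] at this
    linarith
  have ht2 : η * c.μψ ≤ 1 / 2 := by
    have h1 : c.κ * (η * c.μψ) ≤ c.κ * (1 / 2) := by
      rw [mul_left_comm, hc.κ_mul]
      linarith
    exact le_of_mul_le_mul_left h1 hc.κ_pos
  exact contraction_of_error_le hμ hL hη (by linarith) hLμ ht2 hCu (by positivity) (by positivity)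
    (by positivity) hS2 hinner hE

theorem Assumptions.nextU_dist_le (hA : Assumptions c P) (hc : c.Valid) (hn : 0 < n)
    {η : ℝ} (hη : 0 < η) (hηL : η * c.Lu ≤ 1 / 4) (hηκ : η * c.Lu ≤ c.κ / 2)
    (hD : DualGradMapBound c P η) {w : Euc p} (hw : w ∈ effDom P.f) (u : Euc q)
    (π : Equiv.Perm (Fin n)) :
    (1 + η * c.μψ / 2) * ‖nextU P η π w u - P.argmaxU w‖ ^ 2 ≤
      ‖u - P.argmaxU w‖ ^ 2 + 4 / c.μψ * c.Cu * η ^ 3 := by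
  rcases le_total (1 / 3) c.κ with h | h
  · exact hA.nextU_dist_le_of_le_κ hc hn hη hηL h hD hw u π
  · exact hA.nextU_dist_le_of_κ_le hc hn hη hηκ h hD hw u π

end DualEpoch

/-! ### Descent of Ψ₀ over one primal epoch. -/

section PrimalEpoch

/-- z is the exact proximal step along `d`, y the actual one along `g`. Chaining the three-point
inequalities y against z and z against w leaves ⟪g - d, y - z⟫, which the term ‖y - z‖²/(2η) absorbs
at the price (η/2)‖g - d‖². -/
theorem prox_descent {E : Type*} [NormedAddCommGroup E] [InnerProductSpace ℝ E]
    {f : E → EReal} (hf : ProperClosedStronglyConvex 0 f) {η : ℝ} (hη : 0 < η) {w d g y z : E}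
    (hw : w ∈ effDom f) (hy : IsProx f η (w - η • g) y) (hz : IsProx f η (w - η • d) z) :
    realPart f y + ⟪d, y - w⟫_ℝ + ‖y - w‖ ^ 2 / (2 * η) + ‖z - w‖ ^ 2 / (2 * η) ≤
      realPart f w + η / 2 * ‖g - d‖ ^ 2 := by
  have h1 := hy.three_point hf hη (hz.mem_effDom hf)
  have h2 := hz.three_point hf hη hw
  rw [sub_self, norm_zero, norm_sub_rev w z] at h2
  rw [norm_sub_rev z y] at h1
  have e1 : ⟪g, y - z⟫_ℝ + ⟪d, z - w⟫_ℝ = ⟪d, y - w⟫_ℝ + ⟪g - d, y - z⟫_ℝ := by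
    have : y - w = (y - z) + (z - w) := by abel
    rw [this, inner_add_right, inner_sub_left]
    ring
  have h3 : 0 ≤ ⟪g - d, y - z⟫_ℝ + (0 + 1 / η) / 2 * ‖y - z‖ ^ 2 + η / 2 * ‖g - d‖ ^ 2 := by
    have h4 := abs_le.1 (abs_real_inner_le_norm (g - d) (y - z))
    have h5 : (0 + 1 / η) / 2 * ‖y - z‖ ^ 2 + η / 2 * ‖g - d‖ ^ 2 - ‖g - d‖ * ‖y - z‖ =
        (‖y - z‖ - η * ‖g - d‖) ^ 2 / (2 * η) := by
      field_simp
      ring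
    have h6 : 0 ≤ (‖y - z‖ - η * ‖g - d‖) ^ 2 / (2 * η) := by positivity
    linarith
  have h8 : (0 + 1 / η) / 2 * ‖z - w‖ ^ 2 = ‖z - w‖ ^ 2 / (2 * η) := by
    field_simp
    ring
  have h9 : (0 : ℝ) ^ 2 / (2 * η) = 0 := by simp
  rw [h9] at h2
  linarith

variable {n p q : ℕ} {c : Consts} {P : Problem n p q}

theorem mean_deviation_le {c : Consts} {η S N Q R : ℝ} (hη : 0 < η) (hLw : 0 < c.Lw)
    (hΘ : 0 ≤ c.Θw) (hΛ0 : 1 ≤ c.Λ0) (hΛ1 : 0 ≤ c.Λ1) (hQ0 : 0 ≤ Q) (hR0 : 0 ≤ R) (hS0 : 0 ≤ S)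
    (hηL : η * c.Lw ≤ 1 / 5) (hηΛ : η ^ 2 * (10 * c.Λ0 * c.Lw ^ 2 * (3 * c.Θw + 1)) ≤ 1)
    (hN : N ≤ 2 * (c.Λ0 * Q + c.Λ1) + 2 * R)
    (h1 : S ≤ 3 * η ^ 2 * (1 / 2 * (c.Lw ^ 2 * S) + 1 / 2 * (c.Θw * N + c.σw ^ 2) + 1 / 3 * N)) :
    c.Lw ^ 2 * S ≤ 1 / 4 * Q + 1 / 4 * R + 1 / 2 * η ^ 2 * c.Cw := by
  have hη2 : η ^ 2 * c.Lw ^ 2 ≤ 1 / 25 := by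
    rw [← mul_pow]
    nlinarith [mul_pos hη hLw]
  have h2 : c.Lw ^ 2 * S ≤ 3 / 50 * (c.Lw ^ 2 * S) +
      η ^ 2 * c.Lw ^ 2 * ((3 * c.Θw + 2) / 2 * N + 3 / 2 * c.σw ^ 2) := by
    have h3 := mul_le_mul_of_nonneg_left h1 (show 0 ≤ c.Lw ^ 2 by positivity)
    have h4 : η ^ 2 * c.Lw ^ 2 * (c.Lw ^ 2 * S) ≤ 1 / 25 * (c.Lw ^ 2 * S) := by gcongr
    linarith
  -- Uses 3Θ_w + 2 ≤ 2(3Θ_w + 1), to reach the expression bounded in `hηΛ`.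
  have h3 : (3 * c.Θw + 2) / 2 * N ≤
      2 * (3 * c.Θw + 1) * (c.Λ0 * Q + c.Λ1 + R) := by
    have h5 : 0 ≤ c.Λ0 * Q + c.Λ1 + R := by positivity
    calc (3 * c.Θw + 2) / 2 * N ≤ (3 * c.Θw + 2) / 2 * (2 * (c.Λ0 * Q + c.Λ1) + 2 * R) := by
          gcongr
      _ = (3 * c.Θw + 2) * (c.Λ0 * Q + c.Λ1 + R) := by ring
      _ ≤ _ := by
          gcongr
          linarith
  have h4 : η ^ 2 * c.Lw ^ 2 * (3 * c.Θw + 1) * c.Λ0 ≤ 1 / 10 := by linarith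
  have h5 : η ^ 2 * c.Lw ^ 2 * (3 * c.Θw + 1) ≤ 1 / 10 := by
    refine le_trans ?_ h4
    exact le_mul_of_one_le_right (by positivity) hΛ0
  have h6 := mul_le_mul_of_nonneg_right h4 hQ0
  have h7 := mul_le_mul_of_nonneg_right h5 hR0
  have h8 := mul_le_mul_of_nonneg_left h3 (show 0 ≤ η ^ 2 * c.Lw ^ 2 by positivity)
  have h9 : 0 ≤ η ^ 2 * c.Lw ^ 2 * c.σw ^ 2 := by positivity
  have h10 : 0 ≤ η ^ 2 * c.Lw ^ 2 * (c.Λ1 * (3 * c.Θw + 1)) := by positivity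
  rw [Consts.Cw]
  linarith

/-- The error of the average direction of a descent epoch. -/
theorem Assumptions.exists_descent_direction (hA : Assumptions c P) (hc : c.Valid) (hn : 0 < n)
    {η : ℝ} (hη : 0 < η) (hηL : η * c.Lw ≤ 1 / 5)
    (hηΛ : η ^ 2 * (10 * c.Λ0 * c.Lw ^ 2 * (3 * c.Θw + 1)) ≤ 1)
    (hG : PrimalGradMapBound c P η) (w : Euc p) (u : Euc q) (π : Equiv.Perm (Fin n)) :
    ∃ g : Euc p, shuffleEpoch (fun i y => -P.gradW i y u) (η / n) π w = w - η • g ∧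
      ‖g - P.avgGradW w u‖ ^ 2 ≤ 1 / 4 * ‖P.gradMap η w‖ ^ 2 +
        1 / 4 * (c.Lu ^ 2 * ‖u - P.argmaxU w‖ ^ 2) + 1 / 2 * η ^ 2 * c.Cw := by
  obtain ⟨z, hz, hS⟩ := exists_shuffle_path_deviation hn (fun i y => -P.gradW i y u) η π w
  have hS := hS (fun i => -P.gradW i w u) (-P.avgGradW w u)
  refine ⟨(1 / (n : ℝ)) • ∑ k, P.gradW (π k) (z k) u, ?_, ?_⟩
  · rw [hz, Finset.sum_neg_distrib, smul_neg, smul_neg, sub_eq_add_neg]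
  have e : (1 / (n : ℝ)) • ∑ k, P.gradW (π k) (z k) u - P.avgGradW w u =
      (1 / (n : ℝ)) • ∑ k, (P.gradW (π k) (z k) u - P.gradW (π k) w u) := by
    rw [Finset.sum_sub_distrib, Equiv.sum_comp π (fun k => P.gradW k w u), smul_sub,
      hA.avgGradW_eq]
  rw [e]
  set S := (1 / (n : ℝ)) * ∑ k, ‖z k - w‖ ^ 2 with hSdef
  have hS0 : 0 ≤ S := by positivity
  have hA1 : (1 / (n : ℝ)) * ∑ k, ‖P.gradW (π k) (z k) u - P.gradW (π k) w u‖ ^ 2 ≤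
      c.Lw ^ 2 * S := by
    have h1 := average_le_average fun k =>
      pow_le_pow_left₀ (norm_nonneg _) (hA.gradW_sub_left hc (π k) (z k) w u) 2
    simp only [mul_pow, ← Finset.mul_sum] at h1
    refine h1.trans (le_of_eq ?_)
    rw [hSdef]
    ring
  refine ((norm_average_sq_le hn _).trans hA1).trans ?_
  simp only [neg_sub_neg, norm_neg] at hS
  simp only [norm_sub_rev (P.gradW _ w u) (P.gradW _ _ u)] at hS
  simp only [norm_sub_rev (P.avgGradW w u)] at hS
  have hV := hA.variance_w w u
  set N := ‖P.avgGradW w u‖ ^ 2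
  set V := (1 / (n : ℝ)) * ∑ k, ‖P.gradW k w u - P.avgGradW w u‖ ^ 2
  set Q := ‖P.gradMap η w‖ ^ 2
  set R := c.Lu ^ 2 * ‖u - P.argmaxU w‖ ^ 2 with hR
  have hQ0 : 0 ≤ Q := by positivity
  have hR0 : 0 ≤ R := by positivity
  have hΘ := hc.Θw_nonneg
  have hΛ0 := hc.one_le_Λ0
  have hΛ1 := hc.Λ1_nonneg
  have hLw := hc.Lw_pos
  -- Passes from ∇_w H(w, u) to ∇Φ₀(w) = ∇_w H(w, u*(w)), where the growth condition applies.
  have hN : N ≤ 2 * (c.Λ0 * Q + c.Λ1) + 2 * R := by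
    have h1 := norm_sub_sq_le_two_mul (P.avgGradW w u) (P.avgGradW w (P.argmaxU w)) 0
    rw [sub_zero, sub_zero] at h1
    have h2 := hG w (hA.effDom_phi w)
    rw [hA.gradPhi_eq hc hn] at h2
    have h3 := pow_le_pow_left₀ (norm_nonneg _)
      (hA.avgGradW_sub_right hc hn w u (P.argmaxU w)) 2
    rw [mul_pow] at h3
    linarith
  have h1 : S ≤ 3 * η ^ 2 * (1 / 2 * (c.Lw ^ 2 * S) + 1 / 2 * (c.Θw * N + c.σw ^ 2) +
      1 / 3 * N) := by
    refine hS.trans ?_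
    gcongr
  exact mean_deviation_le hη hLw hΘ hΛ0 hΛ1 hQ0 hR0 hS0 hηL hηΛ hN h1

/-- Real values of `Ψ₀`. -/
noncomputable def psiReal (P : Problem n p q) (w : Euc p) : ℝ :=
  realPart P.Phi w + realPart P.f w

theorem Assumptions.nextW_mem (hA : Assumptions c P) {η : ℝ} (hη : 0 < η) (w : Euc p) (u : Euc q)
    (π : Equiv.Perm (Fin n)) : nextW P η π w u ∈ effDom P.f :=
  (hA.convex_f.isProx_prox le_rfl hη _).mem_effDom hA.convex_f

theorem Assumptions.nextW_descent (hA : Assumptions c P) (hc : c.Valid) (hn : 0 < n)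
    {η : ℝ} (hη : 0 < η) (hηL : η * c.Lw ≤ 1 / 5) (hηΦ : η * c.LPhi ≤ 1 / 4)
    (hηΛ : η ^ 2 * (10 * c.Λ0 * c.Lw ^ 2 * (3 * c.Θw + 1)) ≤ 1)
    (hG : PrimalGradMapBound c P η) {w : Euc p} (hw : w ∈ effDom P.f) (u : Euc q)
    (π : Equiv.Perm (Fin n)) :
    psiReal P (nextW P η π w u) + 1 / (4 * η) * ‖nextW P η π w u - w‖ ^ 2 +
        η / 4 * ‖P.gradMap η w‖ ^ 2 ≤
      psiReal P w + 5 / 4 * η * (c.Lu ^ 2 * ‖u - P.argmaxU w‖ ^ 2) +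
        1 / 2 * c.Cw * η ^ 3 := by
  obtain ⟨g, hg, hê⟩ := hA.exists_descent_direction hc hn hη hηL hηΛ hG w u π
  have hy := hA.convex_f.isProx_prox le_rfl hη (w - η • g)
  have hz := hA.convex_f.isProx_prox le_rfl hη (w - η • P.gradPhi w)
  have h1 := prox_descent hA.convex_f hη hw hy hz
  have hGz : ‖prox P.f η (w - η • P.gradPhi w) - w‖ ^ 2 / (2 * η) =
      η / 2 * ‖P.gradMap η w‖ ^ 2 := by
    rw [Problem.gradMap, norm_smul, mul_pow, Real.norm_eq_abs, sq_abs, norm_sub_rev]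
    field_simp
  have h2 := hA.phi_le hc hn w (prox P.f η (w - η • g))
  rw [← hA.gradPhi_eq hc hn] at h2
  have hδ : ‖g - P.gradPhi w‖ ^ 2 ≤ 2 * ‖g - P.avgGradW w u‖ ^ 2 +
      2 * (c.Lu ^ 2 * ‖u - P.argmaxU w‖ ^ 2) := by
    have h3 := norm_sub_sq_le_two_mul g (P.avgGradW w u) (P.gradPhi w)
    have h4 := pow_le_pow_left₀ (norm_nonneg _)
      (hA.avgGradW_sub_right hc hn w u (P.argmaxU w)) 2
    rw [mul_pow, ← hA.gradPhi_eq hc hn] at h4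
    linarith
  rw [hGz] at h1
  simp only [psiReal, nextW, hg]
  set y := prox P.f η (w - η • g)
  -- Half of ‖y - w‖²/(2η) pays for the curvature of Φ₀; the other half is kept to pay for the
  -- motion of u*.
  have h5 : c.LPhi * ‖y - w‖ ^ 2 ≤ 1 / (4 * η) * ‖y - w‖ ^ 2 := by
    gcongr
    rw [le_div_iff₀ (by positivity)]
    linarith
  have h6 : ‖y - w‖ ^ 2 / (2 * η) = 2 * (1 / (4 * η) * ‖y - w‖ ^ 2) := by
    field_simp
    ring
  have h7 : η / 2 * ‖g - P.gradPhi w‖ ^ 2 ≤ η / 2 * (2 * (1 / 4 * ‖P.gradMap η w‖ ^ 2 +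
        1 / 4 * (c.Lu ^ 2 * ‖u - P.argmaxU w‖ ^ 2) + 1 / 2 * η ^ 2 * c.Cw) +
      2 * (c.Lu ^ 2 * ‖u - P.argmaxU w‖ ^ 2)) := by
    gcongr
    linarith
  rw [h6] at h1
  linarith

end PrimalEpoch

/-! ### Consequences of η ≤ η̄. -/

section StepSizes

variable {c : Consts}

theorem Consts.Valid.LPhi_pos (hc : c.Valid) : 0 < c.LPhi :=
  mul_pos (by linarith [hc.κ_pos]) hc.Lw_pos

theorem Consts.Valid.Cu_nonneg (hc : c.Valid) : 0 ≤ c.Cu := by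
  have := hc.dΛ1_nonneg
  have := hc.Θu_nonneg
  rw [Consts.Cu]
  positivity

theorem Consts.Valid.Cw_nonneg (hc : c.Valid) : 0 ≤ c.Cw := by
  have := hc.Λ1_nonneg
  have := hc.Θw_nonneg
  rw [Consts.Cw]
  positivity

theorem Consts.Valid.ηbar_pos (hc : c.Valid) : 0 < c.ηbar := by
  have := hc.κ_pos
  have := hc.Lu_pos
  have := hc.Lw_pos
  have := hc.LPhi_pos
  have := hc.Lf_nonneg
  have := hc.Θw_nonneg
  have := hc.Θu_nonneg
  have := hc.μψ_pos
  have h1 : 0 < c.Λ0 := by linarith [hc.one_le_Λ0]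
  have h2 : 0 < c.dΛ0 := by linarith [hc.one_le_dΛ0]
  simp only [Consts.ηbar, lt_min_iff]
  refine ⟨by positivity, by positivity, by positivity, by positivity, by positivity⟩

theorem Consts.Valid.step_le_κ (hc : c.Valid) {η : ℝ} (h : η ≤ c.ηbar) :
    c.ηhat η * c.Lu ≤ 1 / 4 := by
  have := hc.κ_pos
  have := hc.Lu_pos
  have h1 : η ≤ 1 / (60 * c.κ ^ 2 * c.Lu) := h.trans (min_le_left _ _)
  rw [le_div_iff₀ (by positivity)] at h1
  rw [Consts.ηhat]
  linarith

theorem Consts.Valid.step_sq_le (hc : c.Valid) {η : ℝ} (hη : 0 < η) (h : η ≤ c.ηbar) :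
    η ^ 2 * (10 * c.Λ0 * c.Lw ^ 2 * (3 * c.Θw + 1)) ≤ 1 := by
  have := hc.Lw_pos
  have := hc.Θw_nonneg
  have h1 : 0 < c.Λ0 := by linarith [hc.one_le_Λ0]
  have hX : 0 < 10 * c.Λ0 * c.Lw ^ 2 * (3 * c.Θw + 1) := by positivity
  have h2 : η ≤ 1 / √(10 * c.Λ0 * c.Lw ^ 2 * (3 * c.Θw + 1)) :=
    h.trans ((min_le_right _ _).trans (min_le_left _ _))
  rw [le_div_iff₀ (Real.sqrt_pos.2 hX)] at h2
  have h3 := pow_le_pow_left₀ (by positivity) h2 2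
  rwa [mul_pow, Real.sq_sqrt hX.le, one_pow] at h3

/-- Since Λ̂₀(3Θ_u + 2) ≥ 2, the radicand in the fourth entry of `ηbar` is at least 4L_u³.
Multiplied by 15κ, the result reads η̂L_u ≤ κ/2, the condition needed when κ is small. -/
theorem Consts.Valid.step_mul_κ_mul_Lu_le (hc : c.Valid) {η : ℝ} (hη : 0 < η) (h : η ≤ c.ηbar) :
    η * (c.κ * c.Lu) ≤ 1 / 30 := by
  have hκ := hc.κ_pos
  have hL := hc.Lu_pos
  have hμ := hc.μψ_pos
  have hΘ := hc.Θu_nonneg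
  have hΛ := hc.one_le_dΛ0
  set Y := 2 * c.Lu ^ 3 * c.dΛ0 * (3 * c.Θu + 2) + c.μψ ^ 2 with hY
  have hY4 : 4 * c.Lu ^ 3 ≤ Y := by
    have h1 : 1 * 2 ≤ c.dΛ0 * (3 * c.Θu + 2) := by gcongr; linarith
    have h2 := mul_le_mul_of_nonneg_left h1 (show 0 ≤ 2 * c.Lu ^ 3 by positivity)
    nlinarith [sq_nonneg c.μψ]
  have hY0 : 0 < Y := lt_of_lt_of_le (by positivity) hY4
  have h2 : η ≤ √c.Lu / (15 * c.κ * √Y) :=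
    h.trans ((min_le_right _ _).trans ((min_le_right _ _).trans ((min_le_right _ _).trans
      (min_le_left _ _))))
  have hs : 0 < √Y := Real.sqrt_pos.2 hY0
  rw [le_div_iff₀ (by positivity)] at h2
  have h3 := pow_le_pow_left₀ (by positivity) h2 2
  rw [mul_pow, mul_pow, Real.sq_sqrt hY0.le, Real.sq_sqrt hL.le] at h3
  have h4 : η ^ 2 * ((15 * c.κ) ^ 2 * (4 * c.Lu ^ 3)) ≤ c.Lu := by
    refine le_trans ?_ h3
    gcongr
  have h5 : c.Lu * (30 * (η * (c.κ * c.Lu))) ^ 2 ≤ c.Lu * 1 ^ 2 := by linarith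
  have h6 := le_of_sq_le_sq (le_of_mul_le_mul_left h5 hL) zero_le_one
  linarith

theorem Consts.Valid.step_le_Lw (hc : c.Valid) {η : ℝ} (hη : 0 < η) (h : η ≤ c.ηbar) :
    η * c.LPhi ≤ 1 / 4 ∧ η * c.Lw ≤ 1 / 5 := by
  have h1 := hc.Lw_pos
  have h2 := hc.LPhi_pos
  have h3 := hc.Lf_nonneg
  have h4 : c.Lw ≤ c.LPhi := by
    rw [Consts.LPhi]
    nlinarith [hc.κ_pos]
  have h5 : η ≤ 1 / (4 * c.LPhi + c.Lw + c.Lf) :=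
    h.trans ((min_le_right _ _).trans ((min_le_right _ _).trans ((min_le_right _ _).trans
      (min_le_right _ _))))
  rw [le_div_iff₀ (by positivity)] at h5
  have h6 := mul_pos hη h1
  have h7 := mul_nonneg hη.le h3
  have h8 := mul_le_mul_of_nonneg_left h4 hη.le
  constructor <;> linarith

end StepSizes

/-! ### The Lyapunov function and its telescoped decrease. -/

section Potential

variable {n p q : ℕ} {c : Consts} {P : Problem n p q}

/-- The Lyapunov function of the method. -/
noncomputable def potential (c : Consts) (P : Problem n p q) (w : Euc p) (u : Euc q) : ℝ :=
  psiReal P w + c.μψ / 4 * ‖u - P.argmaxU w‖ ^ 2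

theorem Assumptions.potential_step (hA : Assumptions c P) (hc : c.Valid) (hn : 0 < n)
    {η : ℝ} (hη : 0 < η) (hηb : η ≤ c.ηbar) (hG : PrimalGradMapBound c P η)
    (hD : DualGradMapBound c P (c.ηhat η)) {w : Euc p} (hw : w ∈ effDom P.f) (u : Euc q)
    (π π' : Equiv.Perm (Fin n)) :
    potential c P (nextW P η π' w (nextU P (c.ηhat η) π w u)) (nextU P (c.ηhat η) π w u) +
        η / 4 * ‖P.gradMap η w‖ ^ 2 ≤
      potential c P w u + (1 / 2 * c.Cw * η ^ 3 + c.Cu * c.ηhat η ^ 3) := by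
  have hκ := hc.κ_pos
  have hμ := hc.μψ_pos
  have hκμ := hc.κ_mul
  have hκL := hc.step_mul_κ_mul_Lu_le hη hηb
  have hh : 0 < c.ηhat η := by rw [Consts.ηhat]; positivity
  have hhκ : c.ηhat η * c.Lu ≤ c.κ / 2 := by
    have h1 := mul_le_mul_of_nonneg_left hκL (show 0 ≤ 15 * c.κ by positivity)
    rw [Consts.ηhat]
    linarith
  have h1 := hA.nextU_dist_le hc hn hh (hc.step_le_κ hηb) hhκ hD hw u π
  set v := nextU P (c.ηhat η) π w u
  have h2 := hA.nextW_descent hc hn hη (hc.step_le_Lw hη hηb).2 (hc.step_le_Lw hη hηb).1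
    (hc.step_sq_le hη hηb) hG hw v π'
  set y := nextW P η π' w v
  set e := ‖v - P.argmaxU w‖ with he
  set r := ‖y - w‖
  set t := c.ηhat η * c.μψ with ht
  have ht0 : 0 < t := by positivity
  have h3 : ‖v - P.argmaxU y‖ ≤ e + c.κ * r := by
    have h4 := norm_sub_le_norm_sub_add_norm_sub v (P.argmaxU w) (P.argmaxU y)
    have h5 := hA.argmaxU_lipschitz hc hn y w
    rw [norm_sub_rev w y] at h5
    linarith
  -- Young's inequality with parameter t/8, small enough to be paid from the contraction by 1 + t/2.
  have h4 : ‖v - P.argmaxU y‖ ^ 2 ≤ (1 + t / 8) * e ^ 2 + (1 + 8 / t) * (c.κ ^ 2 * r ^ 2) := by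
    refine (pow_le_pow_left₀ (norm_nonneg _) h3 2).trans ?_
    have : (1 + t / 8) * e ^ 2 + (1 + 8 / t) * (c.κ ^ 2 * r ^ 2) - (e + c.κ * r) ^ 2 =
        (t * e - 8 * (c.κ * r)) ^ 2 / (8 * t) := by
      field_simp
      ring
    have h5 : 0 ≤ (t * e - 8 * (c.κ * r)) ^ 2 / (8 * t) := by positivity
    linarith
  -- Because t = 15κ²ημ, the left side is (κL_u/4 + 2/(15η)) r², and κL_u ≤ 1/(30η); the total
  -- 17/(120η) is below 1/(4η).
  have h5 : c.μψ / 4 * ((1 + 8 / t) * (c.κ ^ 2 * r ^ 2)) ≤ 1 / (4 * η) * r ^ 2 := by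
    have h6 : c.μψ / 4 * ((1 + 8 / t) * (c.κ ^ 2 * r ^ 2)) =
        (c.κ * c.Lu / 4 + 2 / (15 * η)) * r ^ 2 := by
      rw [ht, Consts.ηhat, ← hκμ]
      field_simp
      ring
    rw [h6]
    have h7 : c.κ * c.Lu ≤ 1 / (30 * η) := by
      rw [le_div_iff₀ (by positivity)]
      linarith
    have h8 : 1 / (30 * η) / 4 + 2 / (15 * η) ≤ 1 / (4 * η) := by
      rw [← sub_nonneg]
      have : 1 / (4 * η) - (1 / (30 * η) / 4 + 2 / (15 * η)) = 13 / (120 * η) := by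
        field_simp
        norm_num
      rw [this]
      positivity
    gcongr
    linarith
  -- The ratio η̂ = 15κ²η enters here: relative to the weight μ/4 the descent error is a fraction
  -- t/3, which with t/8 from Young's inequality makes 11t/24 ≤ t/2.
  have h6 : 5 / 4 * η * (c.Lu ^ 2 * e ^ 2) = c.μψ / 12 * t * e ^ 2 := by
    rw [ht, Consts.ηhat, ← hκμ]
    ring
  have h7 := mul_le_mul_of_nonneg_left h4 (show 0 ≤ c.μψ / 4 by positivity)
  have h8 := mul_le_mul_of_nonneg_left h1 (show 0 ≤ c.μψ / 4 by positivity)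
  have h9 : c.μψ / 4 * (4 / c.μψ * c.Cu * c.ηhat η ^ 3) = c.Cu * c.ηhat η ^ 3 := by
    field_simp
  have h10 : 0 ≤ c.μψ * t * e ^ 2 := by positivity
  rw [mul_add, h9] at h8
  simp only [potential]
  linarith

theorem Assumptions.psi_eq (hA : Assumptions c P) {w : Euc p} (hw : w ∈ effDom P.f) :
    P.Psi w = ((psiReal P w : ℝ) : EReal) := by
  rw [Problem.Psi, psiReal, EReal.coe_add, hA.coe_realPart_phi, hA.convex_f.coe_realPart hw]

theorem Assumptions.psiStar_le (hA : Assumptions c P) {w : Euc p} (hw : w ∈ effDom P.f) :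
    P.PsiStar.toReal ≤ psiReal P w := by
  have h1 : P.PsiStar ≤ P.Psi w := iInf_le _ w
  rw [hA.psi_eq hw] at h1
  have := EReal.toReal_le_toReal h1 hA.bddBelow.ne' (EReal.coe_ne_top _)
  rwa [EReal.toReal_coe] at this

theorem Assumptions.primalGap_eq (hA : Assumptions c P) {w : Euc p} (hw : w ∈ effDom P.f) :
    primalGap P w = psiReal P w - P.PsiStar.toReal := by
  rw [primalGap, hA.psi_eq hw, EReal.toReal_coe]

theorem Assumptions.le_dualGap (hA : Assumptions c P) (hn : 0 < n) {w : Euc p} {u : Euc q}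
    (hw : w ∈ effDom P.f) (hu : u ∈ effDom P.h) :
    c.μψ / 2 * ‖u - P.argmaxU w‖ ^ 2 ≤ dualGap P w u := by
  have h1 := hA.dual_growth hn w hu
  have h2 : P.lagr w u = ((realPart P.f w + P.avgH w u - realPart P.h u : ℝ) : EReal) := by
    rw [Problem.lagr, EReal.coe_sub, EReal.coe_add, hA.convex_f.coe_realPart hw,
      hA.convex_h.coe_realPart hu]
  rw [dualGap, hA.psi_eq hw, h2, EReal.toReal_coe, EReal.toReal_coe, psiReal]
  linarith

/-- Membership in dom f is carried through the induction because the growth condition in u holds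
only for such w. -/
theorem Assumptions.sum_gradMap_le (hA : Assumptions c P) (hc : c.Valid) (hn : 0 < n)
    {η : ℝ} (hη : 0 < η) (hηb : η ≤ c.ηbar) (hG : PrimalGradMapBound c P η)
    (hD : DualGradMapBound c P (c.ηhat η)) (π π' : ℕ → Equiv.Perm (Fin n)) {w₀ : Euc p}
    (hw₀ : w₀ ∈ effDom P.f) (u₀ : Euc q) (T : ℕ) :
    ((algorithm η (c.ηhat η) π π' w₀ u₀ T).eval P).1 ∈ effDom P.f ∧
    potential c P ((algorithm η (c.ηhat η) π π' w₀ u₀ T).eval P).1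
        ((algorithm η (c.ηhat η) π π' w₀ u₀ T).eval P).2 +
      η / 4 * ∑ t ∈ Finset.range T, ‖P.gradMap η (wIter c P η π π' w₀ u₀ t)‖ ^ 2 ≤
      potential c P w₀ u₀ + T * (1 / 2 * c.Cw * η ^ 3 + c.Cu * c.ηhat η ^ 3) := by
  induction T with
  | zero => simpa [algorithm, Prog.eval] using hw₀
  | succ T ih =>
    rw [algorithm, eval_bind, eval_epoch, Finset.sum_range_succ]
    have h := hA.potential_step hc hn hη hηb hG hD ih.1
      ((algorithm η (c.ηhat η) π π' w₀ u₀ T).eval P).2 (π T) (π' T)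
    refine ⟨hA.nextW_mem hη _ _ _, ?_⟩
    have h2 := ih.2
    simp only [wIter] at h2 ⊢
    push_cast
    linarith

theorem Assumptions.avgSqGradMap_le (hA : Assumptions c P) (hc : c.Valid) (hn : 0 < n)
    {η : ℝ} (hη : 0 < η) (hηb : η ≤ c.ηbar) (hG : PrimalGradMapBound c P η)
    (hD : DualGradMapBound c P (c.ηhat η)) (π π' : ℕ → Equiv.Perm (Fin n)) {w₀ : Euc p}
    (hw₀ : w₀ ∈ effDom P.f) {u₀ : Euc q} (hu₀ : u₀ ∈ effDom P.h) (T : ℕ) :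
    avgSqGradMap c P η π π' w₀ u₀ T ≤
      (24 * primalGap P w₀ + 8 * dualGap P w₀ u₀) / (η * ((T : ℝ) + 1))
        + 8 * c.Cw * η ^ 2 + 8 * c.Cu * c.ηhat η ^ 3 / η := by
  -- T + 1 iterations are unrolled so that the sum includes the gradient mapping at w̃_T.
  obtain ⟨hmem, hsum⟩ := hA.sum_gradMap_le hc hn hη hηb hG hD π π' hw₀ u₀ (T + 1)
  have hμ := hc.μψ_pos
  have h1 : P.PsiStar.toReal ≤ potential c P
      ((algorithm η (c.ηhat η) π π' w₀ u₀ (T + 1)).eval P).1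
      ((algorithm η (c.ηhat η) π π' w₀ u₀ (T + 1)).eval P).2 := by
    refine (hA.psiStar_le hmem).trans (le_add_of_nonneg_right ?_)
    positivity
  have h2 := hA.le_dualGap hn hw₀ hu₀
  have h3 : 0 ≤ c.μψ / 4 * ‖u₀ - P.argmaxU w₀‖ ^ 2 := by positivity
  have h4 : potential c P w₀ u₀ - P.PsiStar.toReal ≤ primalGap P w₀ + dualGap P w₀ u₀ := by
    rw [hA.primalGap_eq hw₀, potential]
    linarith
  have h5 : 0 ≤ primalGap P w₀ := by
    rw [hA.primalGap_eq hw₀]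
    linarith [hA.psiStar_le hw₀]
  have hCw : 0 ≤ c.Cw * η ^ 3 := mul_nonneg hc.Cw_nonneg (by positivity)
  have hCu : 0 ≤ c.Cu * c.ηhat η ^ 3 := by
    have := hc.Cu_nonneg
    have : 0 ≤ c.ηhat η := by rw [Consts.ηhat]; positivity
    positivity
  have hT : (0 : ℝ) < (T : ℝ) + 1 := by positivity
  have h6 := mul_nonneg hT.le hCw
  have h7 := mul_nonneg hT.le hCu
  push_cast at hsum
  -- Multiplying the telescoped bound by 4 gives the coefficients 4, 4, 2, 4; all four quantities
  -- are nonnegative, so they may be enlarged to 24, 8, 8, 8.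
  have h8 : η * ∑ t ∈ Finset.range (T + 1), ‖P.gradMap η (wIter c P η π π' w₀ u₀ t)‖ ^ 2 ≤
      24 * primalGap P w₀ + 8 * dualGap P w₀ u₀ +
        ((T : ℝ) + 1) * (8 * (c.Cw * η ^ 3) + 8 * (c.Cu * c.ηhat η ^ 3)) := by
    linarith
  have e : (24 * primalGap P w₀ + 8 * dualGap P w₀ u₀) / (η * ((T : ℝ) + 1))
        + 8 * c.Cw * η ^ 2 + 8 * c.Cu * c.ηhat η ^ 3 / η =
      (24 * primalGap P w₀ + 8 * dualGap P w₀ u₀ +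
        ((T : ℝ) + 1) * (8 * (c.Cw * η ^ 3) + 8 * (c.Cu * c.ηhat η ^ 3))) /
        (η * ((T : ℝ) + 1)) := by
    field_simp
    ring
  rw [e, avgSqGradMap, le_div_iff₀ (by positivity)]
  refine le_trans (le_of_eq ?_) h8
  field_simp

end Potential

/-! ### Oracle counts. -/

section Counts

variable {n p q : ℕ}

theorem count_bind {α β : Type} (P : Problem n p q) (x : Prog n p q α) (g : α → Prog n p q β) :
    (x.bind g).count P =
      ⟨(x.count P).gradW + ((g (x.eval P)).count P).gradW,
        (x.count P).gradU + ((g (x.eval P)).count P).gradU,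
        (x.count P).proxF + ((g (x.eval P)).count P).proxF,
        (x.count P).proxH + ((g (x.eval P)).count P).proxH⟩ := by
  induction x with
  | ret a => simp [Prog.bind, Prog.count, Prog.eval]
  | gradW i w u k ih => simp [Prog.bind, Prog.count, Prog.eval, ih, Nat.add_right_comm]
  | gradU i w u k ih => simp [Prog.bind, Prog.count, Prog.eval, ih, Nat.add_right_comm]
  | proxF η w k ih => simp [Prog.bind, Prog.count, Prog.eval, ih, Nat.add_right_comm]
  | proxH η w k ih => simp [Prog.bind, Prog.count, Prog.eval, ih, Nat.add_right_comm]

theorem count_ascentLoop (P : Problem n p q) (a : ℝ) (w : Euc p) (l : List (Fin n)) (u : Euc q) :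
    (ascentLoop a w l u).count P = ⟨0, l.length, 0, 0⟩ := by
  induction l generalizing u with
  | nil => rfl
  | cons i is ih => simp [ascentLoop, Prog.count, ih]

theorem count_descentLoop (P : Problem n p q) (a : ℝ) (u : Euc q) (l : List (Fin n)) (w : Euc p) :
    (descentLoop a u l w).count P = ⟨l.length, 0, 0, 0⟩ := by
  induction l generalizing w with
  | nil => rfl
  | cons i is ih => simp [descentLoop, Prog.count, ih]

theorem count_epoch (P : Problem n p q) (η ηh : ℝ) (π π' : Equiv.Perm (Fin n))
    (z : Euc p × Euc q) : (epoch η ηh π π' z).count P = ⟨n, n, 1, 1⟩ := by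
  simp [epoch, count_bind, count_ascentLoop, count_descentLoop, Prog.count, order]

theorem count_algorithm (P : Problem n p q) (η ηh : ℝ) (π π' : ℕ → Equiv.Perm (Fin n))
    (w₀ : Euc p) (u₀ : Euc q) (T : ℕ) :
    (algorithm η ηh π π' w₀ u₀ T).count P = ⟨T * n, T * n, T, T⟩ := by
  induction T with
  | zero => simp [algorithm, Prog.count]
  | succ T ih => simp [algorithm, count_bind, ih, count_epoch, Nat.succ_mul]

end Counts

/-! ### Choice of the complexity constants and selection of an iterate. -/

section Complexity

variable {c : Consts}

theorem exists_complexity_constants (hc : c.Valid) (Δ : ℝ) :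
    ∃ a > (0 : ℝ), ∃ C > (0 : ℝ), ∀ ε > (0 : ℝ), ∀ (η : ℝ) (T : ℕ), η = min (a * ε) c.ηbar →
      T = ⌊C / ε ^ 3⌋₊ →
      8 * Δ / (η * ((T : ℝ) + 1)) + 8 * c.Cw * η ^ 2 + 8 * c.Cu * c.ηhat η ^ 3 / η ≤ ε ^ 2 := by
  have hb := hc.ηbar_pos
  have hCw := hc.Cw_nonneg
  have hCu := hc.Cu_nonneg
  have hκ := hc.κ_pos
  -- With η̂ = 15κ²η both noise terms together equal K η²; 27000 = 8 · 15³. The choice of `a` below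
  -- makes K(aε)² at most ε²/2.
  set K := 8 * c.Cw + 27000 * c.κ ^ 6 * c.Cu with hK
  have hK0 : 0 ≤ K := by positivity
  set D := max Δ 0 with hD
  have hD0 : 0 ≤ D := le_max_right _ _
  set a := 1 / (2 * (K + 1)) with ha
  have ha0 : 0 < a := by positivity
  set M := 16 * D / c.ηbar with hM
  have hM0 : 0 ≤ M := by positivity
  -- The first summand serves η = aε, the second the capped rate η = η̄, and the 1 makes C positive.
  set C := 16 * D / a + M * (M + 1) + 1 with hC
  have hC0 : 0 < C := by positivity
  refine ⟨a, ha0, C, hC0, fun ε hε η T hη hT => ?_⟩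
  have hη0 : 0 < η := by
    rw [hη]
    exact lt_min (by positivity) hb
  have hT1 : C ≤ ε ^ 3 * ((T : ℝ) + 1) := by
    have := Nat.lt_floor_add_one (C / ε ^ 3)
    rw [← hT, div_lt_iff₀ (by positivity)] at this
    linarith
  have hT0 : (0 : ℝ) ≤ T := Nat.cast_nonneg T
  have hmain : 16 * D ≤ ε ^ 2 * (η * ((T : ℝ) + 1)) := by
    rcases min_choice (a * ε) c.ηbar with h | h
    · rw [hη, h]
      have h1 : 16 * D / a ≤ C := by
        have : 0 ≤ M * (M + 1) := by positivity
        linarith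
      rw [div_le_iff₀ ha0] at h1
      have h2 := mul_le_mul_of_nonneg_right hT1 ha0.le
      linarith
    · rw [hη, h]
      have h16 : 16 * D = M * c.ηbar := by
        rw [hM]
        field_simp
      rw [h16]
      -- At the capped rate a large ε needs no iterations at all: ε² ≥ M suffices. Otherwise ε ≤ M +
      -- 1, and C ≥ M(M + 1) ≥ Mε turns the ε³ bound into an ε² bound.
      have hle : M ≤ ε ^ 2 * ((T : ℝ) + 1) := by
        rcases le_total M (ε ^ 2) with h1 | h1
        · nlinarith [mul_nonneg (sq_nonneg ε) hT0]
        · have hεM : ε ≤ M + 1 := by nlinarith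
          have h2 : M * ε ≤ M * (M + 1) := mul_le_mul_of_nonneg_left hεM hM0
          have h3 : 0 ≤ 16 * D / a := by positivity
          have h4 : ε * M ≤ ε * (ε ^ 2 * ((T : ℝ) + 1)) := by linarith
          exact le_of_mul_le_mul_left h4 hε
      have := mul_le_mul_of_nonneg_right hle hb.le
      linarith
  have h1 : 8 * Δ / (η * ((T : ℝ) + 1)) ≤ ε ^ 2 / 2 := by
    rw [div_le_iff₀ (by positivity)]
    have : Δ ≤ D := le_max_left _ _
    linarith
  have h2 : 8 * c.Cw * η ^ 2 + 8 * c.Cu * c.ηhat η ^ 3 / η = K * η ^ 2 := by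
    rw [hK, Consts.ηhat]
    field_simp
    ring
  have h3 : K * η ^ 2 ≤ ε ^ 2 / 2 := by
    have h4 : η ≤ a * ε := hη ▸ min_le_left _ _
    have h5 : K * a ^ 2 ≤ 1 / 2 := by
      rw [ha, div_pow, one_pow, mul_one_div, div_le_iff₀ (by positivity)]
      nlinarith
    calc K * η ^ 2 ≤ K * (a * ε) ^ 2 := by gcongr
      _ = K * a ^ 2 * ε ^ 2 := by ring
      _ ≤ 1 / 2 * ε ^ 2 := by gcongr
      _ = _ := by ring
  linarith

variable {n p q : ℕ} {P : Problem n p q}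

theorem sq_norm_best_le_avgSqGradMap {η : ℝ} {π π' : ℕ → Equiv.Perm (Fin n)} {w₀ : Euc p}
    {u₀ : Euc q} {T s : ℕ} (h : ∀ t ≤ T, ‖P.gradMap η (wIter c P η π π' w₀ u₀ s)‖ ≤
      ‖P.gradMap η (wIter c P η π π' w₀ u₀ t)‖) :
    ‖P.gradMap η (wIter c P η π π' w₀ u₀ s)‖ ^ 2 ≤ avgSqGradMap c P η π π' w₀ u₀ T := by
  have hT : (0 : ℝ) < (T : ℝ) + 1 := by positivity
  rw [avgSqGradMap, one_div_mul_eq_div, le_div_iff₀ hT]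
  have h1 := Finset.card_nsmul_le_sum (Finset.range (T + 1))
    (fun t => ‖P.gradMap η (wIter c P η π π' w₀ u₀ t)‖ ^ 2)
    (‖P.gradMap η (wIter c P η π π' w₀ u₀ s)‖ ^ 2) fun t ht =>
      pow_le_pow_left₀ (norm_nonneg _) (h t (Nat.lt_succ_iff.1 (Finset.mem_range.1 ht))) 2
  rw [Finset.card_range, nsmul_eq_mul] at h1
  push_cast at h1
  linarith

theorem integral_uniform_eq_avgSqGradMap (η : ℝ) (π π' : ℕ → Equiv.Perm (Fin n)) (w₀ : Euc p)
    (u₀ : Euc q) (T : ℕ) :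
    ∫ t : Fin (T + 1), ‖P.gradMap η (wIter c P η π π' w₀ u₀ t)‖ ^ 2
      ∂(PMF.uniformOfFintype (Fin (T + 1))).toMeasure = avgSqGradMap c P η π π' w₀ u₀ T := by
  rw [PMF.integral_eq_sum, avgSqGradMap, ← Fin.sum_univ_eq_sum_range
    (fun t => ‖P.gradMap η (wIter c P η π π' w₀ u₀ t)‖ ^ 2), Finset.mul_sum]
  refine Finset.sum_congr rfl fun t _ => ?_
  simp [ENNReal.toReal_add]

end Complexity

end MinimaxShuffling

theorem mainTheorem6 (c : MinimaxShuffling.Consts) (hc : c.Valid) :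
    -- the hyper-gradient is well defined
    (∀ (n p q : ℕ) (P : MinimaxShuffling.Problem n p q), 0 < n →
      MinimaxShuffling.Assumptions c P →
      (∀ w, P.Phi w ≠ ⊥ ∧ P.Phi w ≠ ⊤) ∧
        Differentiable ℝ (MinimaxShuffling.realPart P.Phi)) ∧
    -- the convergence bound
    (∀ (n p q : ℕ) (P : MinimaxShuffling.Problem n p q), 0 < n →
      MinimaxShuffling.Assumptions c P →
      ∀ η : ℝ, 0 < η → η ≤ c.ηbar →
      MinimaxShuffling.PrimalGradMapBound c P η →
      MinimaxShuffling.DualGradMapBound c P (c.ηhat η) →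
      ∀ (π π' : ℕ → Equiv.Perm (Fin n)),
      ∀ w₀ ∈ MinimaxShuffling.effDom P.f, ∀ u₀ ∈ MinimaxShuffling.effDom P.h,
      ∀ T : ℕ,
        MinimaxShuffling.avgSqGradMap c P η π π' w₀ u₀ T ≤
          (24 * MinimaxShuffling.primalGap P w₀ + 8 * MinimaxShuffling.dualGap P w₀ u₀) /
              (η * ((T : ℝ) + 1))
            + 8 * c.Cw * η ^ 2 + 8 * c.Cu * c.ηhat η ^ 3 / η) ∧
    -- the complexity, with constants that depend only on `c` and on a bound `Δ` for the
    -- initial gap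
    (∀ Δ : ℝ, ∃ a > (0 : ℝ), ∃ C > (0 : ℝ), ∀ ε > (0 : ℝ),
      ∀ (η : ℝ) (T : ℕ), η = min (a * ε) c.ηbar → T = ⌊C / ε ^ 3⌋₊ →
      ∀ (n p q : ℕ) (P : MinimaxShuffling.Problem n p q), 0 < n →
      MinimaxShuffling.Assumptions c P →
      MinimaxShuffling.PrimalGradMapBound c P η →
      MinimaxShuffling.DualGradMapBound c P (c.ηhat η) →
      ∀ (π π' : ℕ → Equiv.Perm (Fin n)),
      ∀ w₀ ∈ MinimaxShuffling.effDom P.f, ∀ u₀ ∈ MinimaxShuffling.effDom P.h,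
      3 * MinimaxShuffling.primalGap P w₀ + MinimaxShuffling.dualGap P w₀ u₀ ≤ Δ →
        MinimaxShuffling.avgSqGradMap c P η π π' w₀ u₀ T ≤ ε ^ 2 ∧
        -- the best iterate is `ε`-stationary
        (∀ s ≤ T,
          (∀ t ≤ T, ‖P.gradMap η (MinimaxShuffling.wIter c P η π π' w₀ u₀ s)‖ ≤
            ‖P.gradMap η (MinimaxShuffling.wIter c P η π π' w₀ u₀ t)‖) →
          ‖P.gradMap η (MinimaxShuffling.wIter c P η π π' w₀ u₀ s)‖ ^ 2 ≤ ε ^ 2) ∧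
        -- a uniformly random iterate is `ε`-stationary in expectation
        (∫ t : Fin (T + 1),
            ‖P.gradMap η (MinimaxShuffling.wIter c P η π π' w₀ u₀ t)‖ ^ 2
            ∂(PMF.uniformOfFintype (Fin (T + 1))).toMeasure ≤ ε ^ 2) ∧
        -- oracle evaluations made by the run of `T` iterations
        (((MinimaxShuffling.algorithm η (c.ηhat η) π π' w₀ u₀ T).count P).gradW : ℝ) ≤
          C * n / ε ^ 3 ∧
        (((MinimaxShuffling.algorithm η (c.ηhat η) π π' w₀ u₀ T).count P).gradU : ℝ) ≤
          C * n / ε ^ 3 ∧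
        (((MinimaxShuffling.algorithm η (c.ηhat η) π π' w₀ u₀ T).count P).proxF : ℝ) ≤
          C / ε ^ 3 ∧
        (((MinimaxShuffling.algorithm η (c.ηhat η) π π' w₀ u₀ T).count P).proxH : ℝ) ≤
          C / ε ^ 3) := by
  refine ⟨fun n p q P hn hA => ⟨fun w => ?_, fun w => ?_⟩,
    fun n p q P hn hA η hη hηb hG hD π π' w₀ hw₀ u₀ hu₀ T =>
      hA.avgSqGradMap_le hc hn hη hηb hG hD π π' hw₀ hu₀ T, fun Δ => ?_⟩
  · rw [hA.phi_eq]
    exact ⟨EReal.coe_ne_bot _, EReal.coe_ne_top _⟩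
  · exact (hA.hasGradientAt_phi hc hn w).differentiableAt
  · obtain ⟨a, ha, C, hC, h⟩ := MinimaxShuffling.exists_complexity_constants hc Δ
    refine ⟨a, ha, C, hC, fun ε hε η T hη hT n p q P hn hA hG hD π π' w₀ hw₀ u₀ hu₀ hΔ => ?_⟩
    have hη0 : 0 < η := by
      rw [hη]
      exact lt_min (by positivity) hc.ηbar_pos
    have hηb : η ≤ c.ηbar := hη ▸ min_le_right _ _
    have havg : MinimaxShuffling.avgSqGradMap c P η π π' w₀ u₀ T ≤ ε ^ 2 := by
      refine (hA.avgSqGradMap_le hc hn hη0 hηb hG hD π π' hw₀ hu₀ T).trans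
        (le_trans ?_ (h ε hε η T hη hT))
      gcongr
      linarith
    have hT1 : (T : ℝ) ≤ C / ε ^ 3 := by
      rw [hT]
      exact Nat.floor_le (by positivity)
    have hTn : ((T * n : ℕ) : ℝ) ≤ C * n / ε ^ 3 := by
      push_cast
      rw [mul_div_right_comm]
      gcongr
    simp only [MinimaxShuffling.count_algorithm]
    refine ⟨havg, fun s _ hs => (MinimaxShuffling.sq_norm_best_le_avgSqGradMap hs).trans havg,
      ?_, hTn, hTn, hT1, hT1⟩
    rw [MinimaxShuffling.integral_uniform_eq_avgSqGradMap]
    exact havg
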